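/- Let $n\ge 0$, let $\zeta=\zeta_{2^{n+1}}\in\mathbb C$ be a primitive $2^{n+1}$-th root of unity, and let $C:\mathbb Q(\zeta)\to\mathbb R^{2^n}$, $\sum_{i=0}^{2^n-1}a_i\zeta^i\mapsto(a_0,\dots,a_{2^n-1})$, be the coefficient embedding. Let $p$ be an odd prime, let $f\in\mathbb F_p[x]$ be an irreducible factor of $x^{2^n}+1$, and let $\mathfrak p=(p,f(\zeta))$ be the corresponding prime ideal of $\mathbb Z[\zeta]$ (where $f(\zeta)$ means $F(\zeta)$ for any $F\in\mathbb Z[x]$ with $F\bmod p=f$). Write $p=2^A m+1$ if $p\equiv 1\pmod 4$ and $p=2^A m-1$ if $p\equiv 3\pmod 4$, with $m$ odd and $A\ge 2$, and set $r=\min(A-1,n)$ if $p\equiv1\pmod 4$ and $r=\min(A,n)$ if $p\equiv 3\pmod 4$. Let $K=\mathbb Q(\zeta^{2^{n-r}})$, with ring of integers $O_K$, and let $\mathfrak c=\mathfrak p\cap O_K$. (1) $\mathfrak p=\bigoplus_{k=0}^{2^{n-r}-1}\zeta^k\mathfrak c$ (an internal direct sum of additive groups). (2) $C(\mathfrak c)$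 is a lattice of rank $2^r$, and $\lambda_1(C(\mathfrak p))=\lambda_1(C(\mathfrak c))$, where $\lambda_1$ is the Euclidean length of a shortest nonzero vector. (3) There is a single algorithm that, given $n$, $p$, the coefficients of $f$ (as residues in $\{0,\dots,p-1\}$), and access to any oracle that solves SVP for $2^r$-dimensional lattices, finds a shortest nonzero vector of $C(\mathfrak p)$ in time $\mathrm{poly}(2^n,\log_2 p)$, the polynomial being independent of $n$, $p$, $f$ and the oracle. Here an oracle solves SVP in dimension $D$ if, given a nonsingular integer $D\times D$ matrix, it returns a shortest nonzero vector of the lattice generated by the rows. Time is bit cost on a random access machine with integer arrays: every step, including an oracle call with its query and its answer, is charged according to the bit lengths of the integers involved. -/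

import Mathlib

open Polynomial NumberField

/-! ### Lattices and the shortest vector problem -/

/-- An integer vector, viewed in Euclidean space. -/
noncomputable def intVec {N : ℕ} (v : Fin N → ℤ) : EuclideanSpace ℝ (Fin N) :=
  WithLp.toLp 2 (fun i => (v i : ℝ))

/-- `v` is a shortest nonzero vector of `Λ`. -/
def IsShortestVector {N : ℕ} (Λ : Submodule ℤ (EuclideanSpace ℝ (Fin N)))
    (v : EuclideanSpace ℝ (Fin N)) : Prop :=
  v ∈ Λ ∧ v ≠ 0 ∧ ∀ w ∈ Λ, w ≠ 0 → ‖v‖ ≤ ‖w‖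

/-- `λ₁(Λ)`, the length of a shortest nonzero vector of `Λ`. -/
noncomputable def lambda1 {N : ℕ} (Λ : Submodule ℤ (EuclideanSpace ℝ (Fin N))) : ℝ :=
  sInf {x : ℝ | ∃ v ∈ Λ, v ≠ 0 ∧ x = ‖v‖}

/-- `O` solves SVP in dimension `D`: given a basis of a full-rank lattice (the rows of a
nonsingular integer matrix) it returns a shortest nonzero vector of that lattice. Nothing is
required of its answers to singular matrices. -/
def SolvesSVP {D : ℕ} (O : Matrix (Fin D) (Fin D) ℤ → Fin D → ℤ) : Prop :=
  ∀ B : Matrix (Fin D) (Fin D) ℤ, B.det ≠ 0 →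
    IsShortestVector (Submodule.span ℤ (Set.range fun i => intVec (B i))) (intVec (O B))

/-! ### Ideals of `ℤ[ζ]` and the coefficient embedding -/

/-- `ζ` as an element of `ℤ[ζ]`. -/
def adjoinGen (ζ : ℂ) : Algebra.adjoin ℤ {ζ} :=
  ⟨ζ, Algebra.self_mem_adjoin_singleton ℤ ζ⟩

/-- The underlying additive group, inside `ℂ`, of an ideal of `ℤ[ζ]`. -/
noncomputable def idealInC {ζ : ℂ} (I : Ideal (Algebra.adjoin ℤ {ζ})) : Submodule ℤ ℂ :=
  (I.restrictScalars ℤ).map (Algebra.adjoin ℤ {ζ}).val.toLinearMap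

/-- The ring of integers of a number field `K ⊆ ℂ`, as an additive subgroup of `ℂ`. -/
noncomputable def integersInC (K : IntermediateField ℚ ℂ) : Submodule ℤ ℂ :=
  LinearMap.range (IsScalarTower.toAlgHom ℤ (𝓞 K) ℂ).toLinearMap

/-- The image of `S` under the coefficient embedding
`∑ i < N, aᵢ ζ ^ i ↦ (a₀, …, a_{N-1})` (with rational `aᵢ`) into Euclidean space. It is used
only for `N = [ℚ(ζ) : ℚ]`, where every element of `ℚ(ζ)` has exactly one such expansion. -/
def coeffLattice (ζ : ℂ) (N : ℕ) (S : Submodule ℤ ℂ) :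
    Submodule ℤ (EuclideanSpace ℝ (Fin N)) where
  carrier := {v | ∃ a : Fin N → ℚ, ∑ i, (a i : ℂ) * ζ ^ (i : ℕ) ∈ S ∧
    v = WithLp.toLp 2 (fun i => (a i : ℝ))}
  zero_mem' := ⟨0, by simp, by ext i; simp⟩
  add_mem' := by
    rintro _ _ ⟨a, ha, rfl⟩ ⟨b, hb, rfl⟩
    refine ⟨a + b, ?_, by ext i; simp⟩
    simpa [add_mul, Finset.sum_add_distrib] using S.add_mem ha hb
  smul_mem' := by
    rintro z _ ⟨a, ha, rfl⟩
    refine ⟨z • a, ?_, by ext i; simp⟩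
    simpa [Finset.mul_sum, mul_assoc] using S.smul_mem z ha

/-! ### Oracle programs with bit cost

A program works on finitely many named arrays of integers (a random access machine); array names
are fixed in the program text, indices are computed. Every step is charged by the bit lengths of
the integers (indices included) that it handles. -/

/-- Bit length of an integer. -/
def bitLen (z : ℤ) : ℕ := Nat.size z.natAbs

/-- Memory: the content of array `a` at index `i` is `s a i`. -/
abbrev Mem := ℕ → ℕ → ℤ

/-- Arithmetic operations. -/
inductive BinOp
  | add | sub | mul | div | mod

/-- Integer value of an operation (division with nonnegative remainder; `x / 0 = 0`). -/
def BinOp.eval : BinOp → ℤ → ℤ → ℤ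
  | .add, x, y => x + y
  | .sub, x, y => x - y
  | .mul, x, y => x * y
  | .div, x, y => x / y
  | .mod, x, y => x % y

/-- Expressions: constants, array entries, and arithmetic operations. -/
inductive Expr
  | lit (z : ℤ)
  | get (a : ℕ) (i : Expr)
  | op (o : BinOp) (x y : Expr)

/-- Value of an expression. A negative index is read as index `0`. -/
def Expr.eval (s : Mem) : Expr → ℤ
  | .lit z => z
  | .get a i => s a (i.eval s).toNat
  | .op o x y => o.eval (x.eval s) (y.eval s)

/-- Cost of evaluating an expression. An arithmetic operation is charged the product of the
lengths of its operands, which is enough for schoolbook arithmetic. -/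
def Expr.cost (s : Mem) : Expr → ℕ
  | .lit z => 1 + bitLen z
  | .get a i => i.cost s + 1 + bitLen (i.eval s) + bitLen (s a (i.eval s).toNat)
  | .op _ x y => x.cost s + y.cost s + (1 + bitLen (x.eval s)) * (1 + bitLen (y.eval s))

/-- Programs. -/
inductive Prog
  /-- do nothing -/
  | skip
  /-- `a[i] := e` -/
  | set (a : ℕ) (i e : Expr)
  /-- `c` and then `d` -/
  | seq (c d : Prog)
  /-- if `0 < e` then `c` else `d` -/
  | ite (e : Expr) (c d : Prog)
  /-- while `0 < e` do `c` -/
  | loop (e : Expr) (c : Prog)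
  /-- ask the oracle about the matrix stored in array `q`, store its answer in array `b` -/
  | call (q b : ℕ)

/-- The memory `s` after `a[i] := z`. -/
def Mem.set (s : Mem) (a i : ℕ) (z : ℤ) : Mem :=
  fun a' i' => if a' = a ∧ i' = i then z else s a' i'

/-- The `D × D` matrix stored row by row in array `q`. -/
def Mem.matrix (s : Mem) (D q : ℕ) : Matrix (Fin D) (Fin D) ℤ :=
  fun i j => s q (i * D + j)

/-- The memory `s` after the vector `v` has been written to the first entries of array `b`. -/
def Mem.setVec (s : Mem) {D : ℕ} (b : ℕ) (v : Fin D → ℤ) : Mem :=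
  fun a i => if h : a = b ∧ i < D then v ⟨i, h.2⟩ else s a i

/-- `Exec O c s s' t`: with oracle `O`, the program `c` started on memory `s` halts on memory
`s'` at total cost `t`. An oracle call is charged the lengths of the query and of the answer. -/
inductive Exec {D : ℕ} (O : Matrix (Fin D) (Fin D) ℤ → Fin D → ℤ) :
    Prog → Mem → Mem → ℕ → Prop
  | skip (s : Mem) : Exec O .skip s s 1
  | set (s : Mem) (a : ℕ) (i e : Expr) :
      Exec O (.set a i e) s (s.set a (i.eval s).toNat (e.eval s))
        (1 + i.cost s + e.cost s + bitLen (i.eval s) + bitLen (e.eval s))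
  | seq {c d : Prog} {s s' s'' : Mem} {t u : ℕ}
      (h : Exec O c s s' t) (h' : Exec O d s' s'' u) : Exec O (.seq c d) s s'' (1 + t + u)
  | iteTrue {e : Expr} {c d : Prog} {s s' : Mem} {t : ℕ}
      (he : 0 < e.eval s) (h : Exec O c s s' t) : Exec O (.ite e c d) s s' (1 + e.cost s + t)
  | iteFalse {e : Expr} {c d : Prog} {s s' : Mem} {t : ℕ}
      (he : ¬ 0 < e.eval s) (h : Exec O d s s' t) : Exec O (.ite e c d) s s' (1 + e.cost s + t)
  | loopStop {e : Expr} {c : Prog} {s : Mem}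
      (he : ¬ 0 < e.eval s) : Exec O (.loop e c) s s (1 + e.cost s)
  | loopStep {e : Expr} {c : Prog} {s s' s'' : Mem} {t u : ℕ}
      (he : 0 < e.eval s) (h : Exec O c s s' t) (h' : Exec O (.loop e c) s' s'' u) :
      Exec O (.loop e c) s s'' (1 + e.cost s + t + u)
  | call (s : Mem) (q b : ℕ) :
      Exec O (.call q b) s (s.setVec b (O (s.matrix D q)))
        (1 + ∑ i, ∑ j, (1 + bitLen (s.matrix D q i j)) +
          ∑ j, (1 + bitLen (O (s.matrix D q) j)))

/-- The input `(n, p, f)`: array `0` starts with `n, p`, array `1` holds the coefficients of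
`f = F mod p`, as residues in `{0, …, p - 1}`, and all other entries are `0`. -/
def inputMem (n p : ℕ) (F : ℤ[X]) : Mem
  | 0, 0 => n
  | 0, 1 => p
  | 1, i => F.coeff i % (p : ℤ)
  | _, _ => 0

/-- The output: the first `N` entries of array `2`. -/
def outputVec (s : Mem) (N : ℕ) : Fin N → ℤ := fun i => s 2 i

/-! Put `S = 2 ^ (n - r)` and `D = 2 ^ r`. The roots of `f` are primitive `2 ^ (n + 1)`-th roots of
unity, so `deg f` is the order of `p` modulo `2 ^ (n + 1)`. Lifting the exponent shows that this
order is `S` times the order of `p` modulo `2 ^ (r + 1)`, and the latter is 1 or 2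
(`orderOf_two_pow`). The minimal polynomial `g` of the `S`-th power of a root of `f` divides `X ^ D
+ 1`, so its degree is that smaller order. Since `f` divides `g(X ^ S)` and the degrees agree, `f =
g(X ^ S)` up to a constant (`exists_eq_expand`).

Every polynomial is `h = ∑ X ^ k * h_k(X ^ S)` with `k < S`, where the sections `h_k` collect the
coefficients of `h` in one residue class of exponents. Divisibility of `h` by `g(X ^ S)` is
equivalent to divisibility of all `h_k` by `g` (`dvd_sect_of_expand_dvd`). The prime ideal consists
of the values at `ζ` of the integer polynomials of degree below `2 ^ n` that `f` divides modulo `p`;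
its contraction to `K` consists of those with `h = h_0(X ^ S)`. This gives the direct sum. The
coefficient vector of `h` interleaves those of the `h_k`, so the lattice of the ideal is an
orthogonal sum of `S` copies of a `D`-dimensional lattice, and `λ₁` is unchanged.

The algorithm reads `D` and `S` off the power of 2 in `(p - 1) / 2` or `p + 1`, makes `g` monic by
Fermat inversion, hands the oracle a triangular basis of the small lattice, and spaces the answer
out by `S`. The constant `p` lies in the lattice, so any correct answer has entries at most `p` in
absolute value; hence all integers in memory stay short, whatever the oracle
(`natAbs_le_of_isShortestVector`). -/

/-! ### Orders modulo powers of two and the factors of `X ^ 2 ^ n + 1` modulo `p`. -/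

theorem one_add_two_pow_pow {a m : ℕ} (ha : 2 ≤ a) (hm : Odd m) (k : ℕ) :
    ∃ m', Odd m' ∧ (1 + 2 ^ a * m) ^ 2 ^ k = 1 + 2 ^ (a + k) * m' := by
  induction k with
  | zero => exact ⟨m, hm, by simp⟩
  | succ k ih =>
    obtain ⟨m', hm', h⟩ := ih
    obtain ⟨b, rfl⟩ : ∃ b, a = b + 2 := ⟨a - 2, by omega⟩
    -- `(1 + 2 ^ e * m') ^ 2 = 1 + 2 ^ (e + 1) * m' * (1 + 2 ^ (e - 1) * m')`, and the last factor
    -- is odd because `e ≥ 2`.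
    refine ⟨m' * (1 + 2 ^ (b + 1 + k) * m'), hm'.mul ?_, ?_⟩
    · refine Odd.add_even odd_one (Even.mul_right ?_ _)
      exact (Nat.even_pow.2 ⟨even_two, by omega⟩)
    · rw [pow_succ 2 k, pow_mul, h]
      ring

theorem two_pow_mul_odd_cast_ne_zero {k m : ℕ} (hm : Odd m) :
    ((2 ^ k * m : ℕ) : ZMod (2 ^ (k + 1))) ≠ 0 := by
  rw [Ne, ZMod.natCast_eq_zero_iff, pow_succ]
  intro h
  have := Nat.dvd_of_mul_dvd_mul_left (by positivity) h
  exact (Nat.not_even_iff_odd.2 hm) (even_iff_two_dvd.2 this)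

theorem two_pow_dvd_cast_eq_zero {k l m : ℕ} (h : k ≤ l) :
    ((2 ^ l * m : ℕ) : ZMod (2 ^ k)) = 0 := by
  rw [ZMod.natCast_eq_zero_iff]
  exact (pow_dvd_pow 2 h).mul_right m

/-- Orders of an odd number modulo powers of two. -/
theorem orderOf_two_pow {n p A m r : ℕ} (hm : Odd m) (hA : 2 ≤ A)
    (h : p % 4 = 1 ∧ p = 2 ^ A * m + 1 ∧ r = min (A - 1) n ∨
          p % 4 = 3 ∧ p + 1 = 2 ^ A * m ∧ r = min A n) :
    (orderOf (p : ZMod (2 ^ (r + 1))) = 1 ∨ orderOf (p : ZMod (2 ^ (r + 1))) = 2) ∧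
      orderOf (p : ZMod (2 ^ (n + 1))) = orderOf (p : ZMod (2 ^ (r + 1))) * 2 ^ (n - r) := by
  rcases h with ⟨h4, hp, hr⟩ | ⟨h4, hp, hr⟩
  · have h1 : orderOf (p : ZMod (2 ^ (r + 1))) = 1 := by
      rw [orderOf_eq_one_iff, hp]
      push_cast
      have := two_pow_dvd_cast_eq_zero (k := r + 1) (l := A) (m := m) (by omega)
      push_cast at this
      rw [this, zero_add]
    refine ⟨Or.inl h1, ?_⟩
    rw [h1, one_mul]
    rcases Nat.lt_or_ge (A - 1) n with hn | hn
    · have hr' : r = A - 1 := by omega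
      obtain ⟨j, hj⟩ : ∃ j, n - r = j + 1 := ⟨n - r - 1, by omega⟩
      rw [hj]
      apply orderOf_eq_prime_pow
      · obtain ⟨m', hm', h⟩ := one_add_two_pow_pow hA hm j
        rw [hp, add_comm (2 ^ A * m), ← Nat.cast_pow, h, show A + j = n by omega,
          Nat.cast_add, Nat.cast_one, add_eq_left]
        exact two_pow_mul_odd_cast_ne_zero hm'
      · obtain ⟨m', hm', h⟩ := one_add_two_pow_pow hA hm (j + 1)
        rw [hp, add_comm (2 ^ A * m), ← Nat.cast_pow, h, Nat.cast_add, Nat.cast_one, add_eq_left]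
        exact two_pow_dvd_cast_eq_zero (by omega)
    · have : r = n := by omega
      rw [← this, h1]; simp
  -- For `p = 2 ^ A * m - 1` the square is `1 + 2 ^ (A + 1) * m * (2 ^ (A - 1) * m - 1)`. This puts
  -- `p ^ 2` in the scope of `one_add_two_pow_pow` with exponent `A + 1`, which is why `r` is `A`
  -- here and `A - 1` in the other case.
  · obtain ⟨q, hq, hq2⟩ : ∃ q, Odd q ∧ p ^ 2 = 1 + 2 ^ (A + 1) * q := by
      obtain ⟨b, rfl⟩ : ∃ b, A = b + 2 := ⟨A - 2, by omega⟩
      have hm1 : 1 ≤ m := hm.pos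
      have : 2 ≤ 2 ^ (b + 1) * m := by
        have : 2 ^ 1 ≤ 2 ^ (b + 1) := Nat.pow_le_pow_right (by omega) (by omega)
        nlinarith
      obtain ⟨q, hq⟩ : ∃ q, 2 ^ (b + 1) * m = q + 1 := ⟨2 ^ (b + 1) * m - 1, by omega⟩
      refine ⟨m * q, hm.mul ?_, ?_⟩
      · have he : Even (2 ^ (b + 1) * m) := Even.mul_right (Nat.even_pow.2 ⟨even_two, by omega⟩) _
        rw [hq] at he
        simpa [parity_simps] using he
      · have hp' : p = 2 * q + 1 := by
          have : 2 ^ (b + 2) * m = 2 * (2 ^ (b + 1) * m) := by ring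
          omega
        have : 2 ^ (b + 2 + 1) * (m * q) = 4 * (2 ^ (b + 1) * m) * q := by ring
        rw [this, hq, hp']
        ring
    have h12 : (p : ZMod (2 ^ (r + 1))) ^ 2 = 1 := by
      rw [← Nat.cast_pow, hq2, Nat.cast_add, Nat.cast_one, add_eq_left]
      exact two_pow_dvd_cast_eq_zero (by omega)
    refine ⟨(Nat.dvd_prime Nat.prime_two).1 (orderOf_dvd_of_pow_eq_one h12), ?_⟩
    rcases Nat.lt_or_ge A n with hn | hn
    · have hr' : r = A := by omega
      obtain ⟨j, hj⟩ : ∃ j, n - r = j + 1 := ⟨n - r - 1, by omega⟩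
      have h2 : orderOf (p : ZMod (2 ^ (r + 1))) = 2 := by
        refine orderOf_eq_prime h12 ?_
        intro h1
        rw [← Nat.cast_one (R := ZMod _), ZMod.natCast_eq_natCast_iff] at h1
        have : p ≡ 1 [MOD 4] := h1.of_dvd (by
          rw [show 4 = 2 ^ 2 by norm_num]; exact pow_dvd_pow 2 (by omega))
        unfold Nat.ModEq at this
        omega
      rw [h2, hj, ← pow_succ']
      apply orderOf_eq_prime_pow
      · obtain ⟨m', hm', h⟩ := one_add_two_pow_pow (a := A + 1) (by omega) hq j
        rw [pow_succ' 2 j, pow_mul, ← Nat.cast_pow, hq2, ← Nat.cast_pow, h,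
          show A + 1 + j = n by omega, Nat.cast_add, Nat.cast_one, add_eq_left]
        exact two_pow_mul_odd_cast_ne_zero hm'
      · obtain ⟨m', hm', h⟩ := one_add_two_pow_pow (a := A + 1) (by omega) hq (j + 1)
        rw [pow_succ' 2 (j + 1), pow_mul, ← Nat.cast_pow, hq2, ← Nat.cast_pow, h,
          Nat.cast_add, Nat.cast_one, add_eq_left]
        exact two_pow_dvd_cast_eq_zero (by omega)
    · have : r = n := by omega
      subst this
      simp

theorem cyclotomic_two_pow_succ (R : Type*) [CommRing R] (n : ℕ) :
    cyclotomic (2 ^ (n + 1)) R = X ^ 2 ^ n + 1 := by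
  rw [cyclotomic_prime_pow_eq_geom_sum Nat.prime_two]
  simp [Finset.sum_range_succ, add_comm]

/-- The degree is the length of the Frobenius orbit of a root, which is a primitive `2 ^ (n + 1)`-th
root of unity because `X ^ 2 ^ n + 1` is cyclotomic. -/
theorem natDegree_of_irreducible_dvd_X_pow_two_pow_add_one {p n : ℕ} [Fact p.Prime] (hp : p ≠ 2)
    {f : (ZMod p)[X]} (hf : Irreducible f) (hd : f ∣ X ^ 2 ^ n + 1) :
    f.natDegree = orderOf (p : ZMod (2 ^ (n + 1))) := by
  have hc : p.Coprime (2 ^ (n + 1)) :=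
    Nat.Coprime.pow_right _ ((Nat.coprime_primes Fact.out Nat.prime_two).2 hp)
  rw [natDegree_of_dvd_cyclotomic_of_irreducible (K := ZMod p) (p := p) (f := 1) (by simp [ZMod.card]) hc
    (cyclotomic_two_pow_succ (ZMod p) n ▸ hd) hf, ← orderOf_units]
  simp

/-- An irreducible factor of `X ^ 2 ^ n + 1` modulo `p` is a linear or quadratic polynomial in
`X ^ 2 ^ (n - r)`. -/
theorem exists_eq_expand {n p A m r : ℕ} [Fact p.Prime] (hp : p ≠ 2) (hm : Odd m) (hA : 2 ≤ A)
    (h : p % 4 = 1 ∧ p = 2 ^ A * m + 1 ∧ r = min (A - 1) n ∨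
          p % 4 = 3 ∧ p + 1 = 2 ^ A * m ∧ r = min A n)
    {f : (ZMod p)[X]} (hf : Irreducible f) (hd : f ∣ X ^ 2 ^ n + 1) :
    ∃ g : (ZMod p)[X], f = expand (ZMod p) (2 ^ (n - r)) g ∧ Irreducible g ∧ g ∣ X ^ 2 ^ r + 1 ∧
      (g.natDegree = 1 ∨ g.natDegree = 2) := by
  have hrn : r ≤ n := by omega
  obtain ⟨h1, h2⟩ := orderOf_two_pow hm hA h
  have : Fact (Irreducible f) := ⟨hf⟩
  set S := 2 ^ (n - r) with hS
  have hS0 : 0 < S := by positivity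
  have hSr : 2 ^ n = S * 2 ^ r := by rw [hS, ← pow_add]; congr 1; omega
  let β : AdjoinRoot f := AdjoinRoot.root f ^ S
  have hfin : FiniteDimensional (ZMod p) (AdjoinRoot f) :=
    (AdjoinRoot.powerBasis hf.ne_zero).finite
  have hint : IsIntegral (ZMod p) β := Algebra.IsIntegral.isIntegral β
  have hroot : β ^ 2 ^ r + 1 = 0 := by
    obtain ⟨q, hq⟩ := hd
    have : aeval (AdjoinRoot.root f) (X ^ 2 ^ n + 1 : (ZMod p)[X]) = 0 := by
      rw [hq, map_mul, AdjoinRoot.aeval_eq, AdjoinRoot.mk_self, zero_mul]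
    simpa [β, ← pow_mul, ← hSr] using this
  set g := minpoly (ZMod p) β
  have hg : Irreducible g := minpoly.irreducible hint
  have hgd : g ∣ X ^ 2 ^ r + 1 := minpoly.dvd _ _ (by simpa using hroot)
  have hdeg := natDegree_of_irreducible_dvd_X_pow_two_pow_add_one hp hg hgd
  have hdf := natDegree_of_irreducible_dvd_X_pow_two_pow_add_one hp hf hd
  have hfe : f ∣ expand (ZMod p) S g := by
    rw [← AdjoinRoot.mk_eq_zero, ← AdjoinRoot.aeval_eq, expand_aeval]
    exact minpoly.aeval _ _
  have hne : expand (ZMod p) S g ≠ 0 := (expand_ne_zero hS0).2 hg.ne_zero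
  -- Both polynomials have degree the order of `p` modulo `2 ^ (n + 1)`. As `f` need not be monic,
  -- the constant between them is moved into `g`.
  obtain ⟨u, hu⟩ := (associated_of_dvd_of_natDegree_le hfe hne (by
    rw [natDegree_expand, hdeg, hdf, h2])).symm
  obtain ⟨c, hc, hcu⟩ := Polynomial.isUnit_iff.1 u.isUnit
  have hcu' : IsUnit (C c : (ZMod p)[X]) := hc.map C
  have hass : Associated g (g * C c) := ⟨hcu'.unit, rfl⟩
  refine ⟨g * C c, ?_, hass.irreducible hg, hass.dvd_iff_dvd_left.1 hgd, ?_⟩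
  · rw [map_mul, expand_C, ← hu, hcu]
  · rw [natDegree_mul_C hc.ne_zero, hdeg]
    exact h1

/-! ### Splitting a polynomial by the residue of its exponents. -/

section Sections

variable {R : Type*} [CommRing R]

/-- The polynomial whose `j`-th coefficient is the coefficient of `h` at `k + j * S`. -/
noncomputable def sect (S k : ℕ) (h : R[X]) : R[X] :=
  ∑ j ∈ Finset.range (h.natDegree + 1), monomial j (h.coeff (k + j * S))

theorem coeff_sect {S : ℕ} (hS : 0 < S) (k : ℕ) (h : R[X]) (j : ℕ) :
    (sect S k h).coeff j = h.coeff (k + j * S) := by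
  simp only [sect, finsetSum_coeff, coeff_monomial, Finset.sum_ite_eq', Finset.mem_range]
  split_ifs with hj
  · rfl
  · refine (coeff_eq_zero_of_natDegree_lt ?_).symm
    have : j ≤ j * S := Nat.le_mul_of_pos_right j hS
    omega

theorem degree_sect_lt {S : ℕ} (hS : 0 < S) {D : ℕ} (k : ℕ) {h : R[X]}
    (hd : h.degree < ((D * S : ℕ) : WithBot ℕ)) : (sect S k h).degree < (D : WithBot ℕ) := by
  rw [degree_lt_iff_coeff_zero] at hd ⊢
  intro j hj
  rw [coeff_sect hS]
  apply hd
  have : D * S ≤ j * S := Nat.mul_le_mul_right S hj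
  omega

theorem map_sect {R' : Type*} [CommRing R'] (φ : R →+* R') {S : ℕ} (hS : 0 < S) (k : ℕ)
    (h : R[X]) : (sect S k h).map φ = sect S k (h.map φ) := by
  ext j
  simp [coeff_sect hS]

theorem sum_sect {S : ℕ} (hS : 0 < S) (h : R[X]) :
    ∑ k ∈ Finset.range S, X ^ k * expand R S (sect S k h) = h := by
  ext i
  simp only [finsetSum_coeff, coeff_X_pow_mul', coeff_expand hS, coeff_sect hS]
  have hlt := Nat.mod_lt i hS
  rw [Finset.sum_eq_single (i % S)]
  · have h1 : i % S ≤ i := Nat.mod_le _ _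
    have h2 : i - i % S = S * (i / S) := by
      have := Nat.mod_add_div i S
      omega
    rw [if_pos h1, h2, if_pos (dvd_mul_right _ _), Nat.mul_div_cancel_left _ hS, mul_comm,
      Nat.mod_add_div]
  · intro k hk hne
    rw [Finset.mem_range] at hk
    split_ifs with h1 h2
    · exfalso
      obtain ⟨c, hc⟩ := h2
      apply hne
      have : i = k + S * c := by omega
      rw [this, Nat.add_mul_mod_self_left, Nat.mod_eq_of_lt hk]
    · rfl
    · rfl
  · intro hn
    exact absurd (Finset.mem_range.2 hlt) hn

/-- `contract` is linear over polynomials in `X ^ S`, so contracting a shift of `h` yields a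
multiple of `g`. The shift by `S - k` moves the `k`-th residue class to exponents divisible by `S`
at the price of one extra factor `X`, which cancels since `g` is coprime to `X`. -/
theorem dvd_sect_of_expand_dvd {S : ℕ} (hS : 0 < S) {g h : R[X]} (hX : IsCoprime g X)
    (H : expand R S g ∣ h) {k : ℕ} (hk : k < S) : g ∣ sect S k h := by
  obtain ⟨q, rfl⟩ := H
  have key : X * sect S k (expand R S g * q) = contract S (X ^ (S - k) * q) * g := by
    rw [← contract_mul_expand hS.ne']
    ext j
    rw [coeff_contract hS.ne', mul_assoc, mul_comm q, coeff_X_pow_mul']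
    cases j with
    | zero => rw [if_neg (by omega)]; simp
    | succ j =>
      have : S ≤ (j + 1) * S := Nat.le_mul_of_pos_left S (by omega)
      rw [coeff_X_mul, coeff_sect hS, if_pos (by omega)]
      congr 1
      rw [add_mul] at this ⊢
      omega
  exact hX.dvd_of_dvd_mul_left (key ▸ dvd_mul_left _ _)

theorem isCoprime_X_of_dvd_X_pow_add_one {g : R[X]} {D : ℕ} (hD : D ≠ 0) (hg : g ∣ X ^ D + 1) :
    IsCoprime g X := by
  refine IsCoprime.of_isCoprime_of_dvd_left ?_ hg
  obtain ⟨e, rfl⟩ := Nat.exists_eq_succ_of_ne_zero hD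
  exact ⟨1, -X ^ e, by rw [Nat.succ_eq_add_one, pow_succ]; ring⟩

theorem eq_sum_range_of_degree_lt {h : R[X]} {n : ℕ} (hd : h.degree < (n : WithBot ℕ)) :
    h = ∑ i ∈ Finset.range n, C (h.coeff i) * X ^ i := by
  ext j
  simp only [finsetSum_coeff, coeff_C_mul_X_pow, Finset.sum_ite_eq, Finset.mem_range]
  split_ifs with hj
  · rfl
  · exact coeff_eq_zero_of_degree_lt (hd.trans_le (by exact_mod_cast not_lt.1 hj))

end Sections

/-! ### Lattices of integer polynomials and their bases. -/

/-- The coefficient vector of an integer polynomial. -/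
noncomputable def coefVec (N : ℕ) : ℤ[X] →ₗ[ℤ] EuclideanSpace ℝ (Fin N) where
  toFun h := intVec fun i : Fin N => h.coeff i
  map_add' _ _ := by ext i; simp [intVec]
  map_smul' _ _ := by ext i; simp [intVec]

theorem coefVec_eq (N : ℕ) (h : ℤ[X]) : coefVec N h = intVec fun i : Fin N => h.coeff i := rfl

theorem intVec_injective (N : ℕ) : Function.Injective (intVec (N := N)) := by
  intro v w h
  ext i
  have := congrArg (fun x : EuclideanSpace ℝ (Fin N) => x i) h
  simpa [intVec] using this

theorem coefVec_injOn {N : ℕ} {h h' : ℤ[X]} (hd : h.degree < (N : WithBot ℕ))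
    (hd' : h'.degree < (N : WithBot ℕ)) (e : coefVec N h = coefVec N h') : h = h' := by
  ext i
  by_cases hi : i < N
  · exact congrFun (intVec_injective N e) ⟨i, hi⟩
  · rw [degree_lt_iff_coeff_zero] at hd hd'
    rw [hd i (by omega), hd' i (by omega)]

theorem norm_sq_coefVec (N : ℕ) (h : ℤ[X]) :
    ‖coefVec N h‖ ^ 2 = ∑ i ∈ Finset.range N, (h.coeff i : ℝ) ^ 2 := by
  rw [EuclideanSpace.real_norm_sq_eq, ← Fin.sum_univ_eq_sum_range (fun i => (h.coeff i : ℝ) ^ 2)]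
  rfl

theorem norm_coefVec_expand {S D : ℕ} (hS : 0 < S) (h : ℤ[X]) :
    ‖coefVec (D * S) (expand ℤ S h)‖ = ‖coefVec D h‖ := by
  rw [← sq_eq_sq₀ (norm_nonneg _) (norm_nonneg _), norm_sq_coefVec, norm_sq_coefVec]
  symm
  apply Finset.sum_of_injOn (fun j => j * S)
  · intro a _ b _ hab
    exact Nat.eq_of_mul_eq_mul_right hS hab
  · intro a ha
    simp only [Finset.coe_range, Set.mem_Iio] at ha ⊢
    exact Nat.mul_lt_mul_of_pos_right ha hS
  · intro i hi hn
    rw [coeff_expand hS, if_neg]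
    · simp
    · rintro ⟨c, rfl⟩
      apply hn
      refine ⟨c, ?_, mul_comm _ _⟩
      rw [Finset.mem_range, mul_comm] at hi
      exact Finset.mem_coe.2 (Finset.mem_range.2 (Nat.lt_of_mul_lt_mul_right hi))
  · intro j _
    rw [coeff_expand_mul hS]

theorem norm_coefVec_sect_le {S D : ℕ} (hS : 0 < S) {k : ℕ} (hk : k < S) (h : ℤ[X]) :
    ‖coefVec D (sect S k h)‖ ≤ ‖coefVec (D * S) h‖ := by
  rw [← sq_le_sq₀ (norm_nonneg _) (norm_nonneg _), norm_sq_coefVec, norm_sq_coefVec]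
  have hinj : Set.InjOn (fun j => k + j * S) (Finset.range D : Set ℕ) := by
    intro a _ b _ hab
    exact Nat.eq_of_mul_eq_mul_right hS (Nat.add_left_cancel hab)
  calc ∑ j ∈ Finset.range D, ((sect S k h).coeff j : ℝ) ^ 2
      = ∑ i ∈ (Finset.range D).image (fun j => k + j * S), (h.coeff i : ℝ) ^ 2 := by
        rw [Finset.sum_image hinj]
        simp [coeff_sect hS]
    _ ≤ _ := by
        refine Finset.sum_le_sum_of_subset_of_nonneg ?_ fun _ _ _ => sq_nonneg _
        intro i hi
        obtain ⟨j, hj, rfl⟩ := Finset.mem_image.1 hi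
        rw [Finset.mem_range] at hj ⊢
        have : (j + 1) * S ≤ D * S := Nat.mul_le_mul_right S hj
        rw [add_mul] at this
        omega

/-- Integer polynomials of degree less than `N` divisible by `g` modulo `p`. -/
noncomputable def polyLattice (p N : ℕ) (g : (ZMod p)[X]) : Submodule ℤ ℤ[X] where
  carrier := {h | h.degree < (N : WithBot ℕ) ∧ g ∣ h.map (Int.castRingHom (ZMod p))}
  zero_mem' := ⟨by simp, by simp⟩
  add_mem' := by
    rintro a b ⟨ha, ha'⟩ ⟨hb, hb'⟩
    refine ⟨(degree_add_le a b).trans_lt (max_lt ha hb), ?_⟩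
    rw [Polynomial.map_add]
    exact dvd_add ha' hb'
  smul_mem' := by
    rintro z a ⟨ha, ha'⟩
    refine ⟨(degree_smul_le z a).trans_lt ha, ?_⟩
    rw [zsmul_eq_mul, Polynomial.map_mul]
    exact ha'.mul_left _

theorem mem_polyLattice {p N : ℕ} {g : (ZMod p)[X]} {h : ℤ[X]} :
    h ∈ polyLattice p N g ↔
      h.degree < (N : WithBot ℕ) ∧ g ∣ h.map (Int.castRingHom (ZMod p)) := Iff.rfl

/-- The rows of a triangular basis of `polyLattice p N g`, where `G` is a monic lift of `g` of
degree `d`. -/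
noncomputable def latticeRow (p d : ℕ) (G : ℤ[X]) (i : ℕ) : ℤ[X] :=
  if i < d then C (p : ℤ) * X ^ i else X ^ (i - d) * G

/-- Divide by `G`: the remainder vanishes modulo `p` and has degree below `d`, so it is a
combination of the rows `p * X ^ i`, and the quotient supplies the coefficients of the rows `X ^ (i
- d) * G`. -/
theorem polyLattice_eq_span {p N d : ℕ} {G : ℤ[X]} (hG : G.Monic) (hGd : G.natDegree = d)
    (hdN : d ≤ N) (hp : p ≠ 1) :
    polyLattice p N (G.map (Int.castRingHom (ZMod p))) =
      Submodule.span ℤ (Set.range fun i : Fin N => latticeRow p d G i) := by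
  have : Nontrivial (ZMod p) := ZMod.nontrivial_iff.2 hp
  have hGdeg : G.degree = d := by rw [degree_eq_natDegree hG.ne_zero, hGd]
  apply le_antisymm
  · rintro h ⟨hd, hdvd⟩
    have hmem (i : ℕ) (hi : i < N) : latticeRow p d G i ∈
        Submodule.span ℤ (Set.range fun i : Fin N => latticeRow p d G i) :=
      Submodule.subset_span ⟨⟨i, hi⟩, rfl⟩
    rw [← modByMonic_add_div h G]
    refine Submodule.add_mem _ ?_ ?_
    · have hz : (h %ₘ G).map (Int.castRingHom (ZMod p)) = 0 := by
        rw [map_modByMonic _ hG, (modByMonic_eq_zero_iff_dvd (hG.map _)).2 hdvd]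
      rw [eq_sum_range_of_degree_lt (h := h %ₘ G) (n := d) (hGdeg ▸ degree_modByMonic_lt h hG)]
      refine Submodule.sum_mem _ fun i hi => ?_
      rw [Finset.mem_range] at hi
      have hc : ((h %ₘ G).coeff i : ZMod p) = 0 := by
        simpa using congrArg (fun q => coeff q i) hz
      obtain ⟨u, hu⟩ := (ZMod.intCast_zmod_eq_zero_iff_dvd _ p).1 hc
      have := Submodule.smul_mem _ u (hmem i (by omega))
      convert this using 1
      rw [latticeRow, if_pos hi, hu, zsmul_eq_mul, eq_intCast C, eq_intCast C]
      push_cast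
      ring
    · have hq : (h /ₘ G).degree < ((N - d : ℕ) : WithBot ℕ) := by
        by_cases h0 : h /ₘ G = 0
        · rw [h0, degree_zero]; exact WithBot.bot_lt_coe _
        · have hne : h ≠ 0 := by rintro rfl; simp at h0
          rw [degree_eq_natDegree h0, natDegree_divByMonic h hG, hGd]
          rw [degree_eq_natDegree hne] at hd
          have hd' : h.natDegree < N := by exact_mod_cast hd
          have : d ≤ h.natDegree := by
            by_contra hlt
            apply h0
            rw [divByMonic_eq_zero_iff hG, hGdeg, degree_eq_natDegree hne]
            exact_mod_cast not_le.1 hlt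
          exact_mod_cast (by omega : h.natDegree - d < N - d)
      rw [eq_sum_range_of_degree_lt hq, Finset.mul_sum]
      refine Submodule.sum_mem _ fun i hi => ?_
      rw [Finset.mem_range] at hi
      have := Submodule.smul_mem _ ((h /ₘ G).coeff i) (hmem (i + d) (by omega))
      convert this using 1
      rw [latticeRow, if_neg (by omega), zsmul_eq_mul, Nat.add_sub_cancel, eq_intCast C]
      ring
  · rw [Submodule.span_le]
    rintro _ ⟨⟨i, hi⟩, rfl⟩
    simp only [latticeRow]
    split_ifs with hid
    · refine ⟨(degree_C_mul_X_pow_le _ _).trans_lt (by exact_mod_cast hi), ?_⟩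
      simp
    · refine ⟨?_, ?_⟩
      · rw [hG.degree_mul, degree_X_pow, hGdeg]
        exact_mod_cast (by omega : i - d + d < N)
      · rw [Polynomial.map_mul]
        exact dvd_mul_left _ _

/-- The coefficients of `latticeRow p d G` as a square matrix. -/
noncomputable def latticeMatrix (p d : ℕ) (G : ℤ[X]) (N : ℕ) : Matrix (Fin N) (Fin N) ℤ :=
  fun i j => (latticeRow p d G i).coeff j

/-- Since `G` is monic of degree `d`, the matrix is triangular with diagonal entries `p` and 1. The
oracle's promise covers nonsingular queries only. -/
theorem det_latticeMatrix_ne_zero {p N d : ℕ} {G : ℤ[X]} (hG : G.Monic) (hGd : G.natDegree = d)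
    (hp : p ≠ 0) : (latticeMatrix p d G N).det ≠ 0 := by
  rw [Matrix.det_of_isLowerTriangular, Finset.prod_ne_zero_iff]
  · rintro i -
    simp only [latticeMatrix, latticeRow]
    split_ifs with h
    · simpa [coeff_C_mul, coeff_X_pow] using hp
    · rw [coeff_X_pow_mul', if_pos (by omega), show (i : ℕ) - (i - d) = d by omega, ← hGd,
        hG.coeff_natDegree]
      exact one_ne_zero
  · intro i j (hij : j > i)
    have hij : (i : ℕ) < j := hij
    simp only [latticeMatrix, latticeRow]
    split_ifs with h
    · rw [coeff_C_mul, coeff_X_pow, if_neg (by omega), mul_zero]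
    · rw [coeff_X_pow_mul', if_pos (by omega)]
      exact coeff_eq_zero_of_natDegree_lt (by omega)

theorem map_coefVec_polyLattice {p N d : ℕ} {G : ℤ[X]} (hG : G.Monic) (hGd : G.natDegree = d)
    (hdN : d ≤ N) (hp : p ≠ 1) :
    (polyLattice p N (G.map (Int.castRingHom (ZMod p)))).map (coefVec N) =
      Submodule.span ℤ (Set.range fun i => intVec (latticeMatrix p d G N i)) := by
  rw [polyLattice_eq_span hG hGd hdN hp, Submodule.map_span, ← Set.range_comp]
  rfl

theorem finrank_polyLattice {p N d : ℕ} {G : ℤ[X]} (hG : G.Monic) (hGd : G.natDegree = d)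
    (hdN : d ≤ N) (hp : p ≠ 1) (hp0 : p ≠ 0) :
    Module.finrank ℤ (polyLattice p N (G.map (Int.castRingHom (ZMod p)))) = N := by
  rw [polyLattice_eq_span hG hGd hdN hp, finrank_span_eq_card, Fintype.card_fin]
  have hli := Matrix.linearIndependent_rows_of_det_ne_zero
    (det_latticeMatrix_ne_zero (N := N) hG hGd hp0)
  let φ : ℤ[X] →ₗ[ℤ] (Fin N → ℤ) := LinearMap.pi fun i => lcoeff ℤ (i : ℕ)
  exact LinearIndependent.of_comp φ hli

theorem coeff_X_pow_mul_expand {R : Type*} [CommRing R] {S : ℕ} (q : R[X]) {k i : ℕ} (hk : k < S)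
    (hi : i < S) (j : ℕ) :
    (X ^ k * expand R S q).coeff (i + j * S) = if k = i then q.coeff j else 0 := by
  have hS : 0 < S := by omega
  rw [coeff_X_pow_mul']
  split_ifs with h1 h2 h2
  · rw [h2, Nat.add_sub_cancel_left, coeff_expand_mul hS]
  · rw [coeff_expand hS, if_neg]
    rintro ⟨c, hc⟩
    apply h2
    have h3 : i + S * j = k + S * c := by rw [mul_comm S j]; omega
    have h4 := congrArg (· % S) h3
    simpa [Nat.mod_eq_of_lt hk, Nat.mod_eq_of_lt hi] using h4.symm
  · omega
  · rfl

theorem degree_X_pow_mul_expand_lt {R : Type*} [CommRing R] {S D : ℕ} {q : R[X]} {k : ℕ}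
    (hk : k < S) (hq : q.degree < (D : WithBot ℕ)) :
    (X ^ k * expand R S q).degree < ((D * S : ℕ) : WithBot ℕ) := by
  rw [degree_lt_iff_coeff_zero] at hq ⊢
  intro m hm
  have hS : 0 < S := by omega
  rw [← Nat.mod_add_div m S, mul_comm S, coeff_X_pow_mul_expand q hk (Nat.mod_lt _ hS)]
  split_ifs
  · exact hq _ ((Nat.le_div_iff_mul_le hS).2 hm)
  · rfl

theorem degree_expand_lt {R : Type*} [CommRing R] {S D : ℕ} (hS : 0 < S) {q : R[X]}
    (hq : q.degree < (D : WithBot ℕ)) :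
    (expand R S q).degree < ((D * S : ℕ) : WithBot ℕ) := by
  simpa using degree_X_pow_mul_expand_lt hS hq

/-! ### Ideals of `ℤ[ζ]` as lattices of polynomials. -/

section Cyclotomic

variable {n : ℕ} {ζ : ℂ}

theorem minpoly_rat_of_isPrimitiveRoot_two_pow (hζ : IsPrimitiveRoot ζ (2 ^ (n + 1))) :
    minpoly ℚ ζ = X ^ 2 ^ n + 1 := by
  rw [← cyclotomic_eq_minpoly_rat hζ (by positivity), cyclotomic_two_pow_succ]

theorem aeval_eq_zero_iff_of_isPrimitiveRoot_two_pow (hζ : IsPrimitiveRoot ζ (2 ^ (n + 1)))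
    (h : ℤ[X]) : aeval ζ h = 0 ↔ X ^ 2 ^ n + 1 ∣ h := by
  rw [← cyclotomic_two_pow_succ, cyclotomic_eq_minpoly hζ (by positivity)]
  exact minpoly.isIntegrallyClosed_dvd_iff (hζ.isIntegral (by positivity)) h

theorem degree_X_pow_two_pow_add_one (R : Type*) [CommRing R] [Nontrivial R] (n : ℕ) :
    (X ^ 2 ^ n + 1 : R[X]).degree = ((2 ^ n : ℕ) : WithBot ℕ) := by
  have := degree_X_pow_add_C (R := R) (n := 2 ^ n) (by positivity) 1
  simpa using this

theorem monic_X_pow_two_pow_add_one (R : Type*) [CommRing R] (n : ℕ) :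
    (X ^ 2 ^ n + 1 : R[X]).Monic := by
  simpa using monic_X_pow_add_C (R := R) (n := 2 ^ n) 1 (by positivity)

theorem eq_zero_of_aeval_eq_zero (hζ : IsPrimitiveRoot ζ (2 ^ (n + 1))) {h : ℚ[X]}
    (hd : h.degree < ((2 ^ n : ℕ) : WithBot ℕ)) (h0 : aeval ζ h = 0) : h = 0 := by
  by_contra hne
  have := minpoly.degree_le_of_ne_zero ℚ ζ hne h0
  rw [minpoly_rat_of_isPrimitiveRoot_two_pow hζ, degree_X_pow_two_pow_add_one] at this
  exact absurd hd (not_lt.2 this)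

theorem degree_map_intCast (h : ℤ[X]) : (h.map (Int.castRingHom ℚ)).degree = h.degree :=
  degree_map_eq_of_injective Int.cast_injective h

theorem aeval_map_intCast (ζ : ℂ) (h : ℤ[X]) :
    aeval ζ (h.map (Int.castRingHom ℚ)) = aeval ζ h := aeval_map_algebraMap ℚ ζ h

theorem eq_zero_of_aeval_int_eq_zero (hζ : IsPrimitiveRoot ζ (2 ^ (n + 1))) {h : ℤ[X]}
    (hd : h.degree < ((2 ^ n : ℕ) : WithBot ℕ)) (h0 : aeval ζ h = 0) : h = 0 := by
  have := eq_zero_of_aeval_eq_zero hζ (h := h.map (Int.castRingHom ℚ))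
    (by rwa [degree_map_intCast]) (by rwa [aeval_map_intCast])
  exact (Polynomial.map_eq_zero_iff Int.cast_injective).1 this

/-- The powers of `ζ` below `2 ^ n` are linearly independent over `ℚ`, so the rational expansion
allowed by `coeffLattice` has to be the integral one given by the polynomial. -/
theorem coeffLattice_map (hζ : IsPrimitiveRoot ζ (2 ^ (n + 1))) (M : Submodule ℤ ℤ[X])
    (hM : ∀ h ∈ M, h.degree < ((2 ^ n : ℕ) : WithBot ℕ)) :
    coeffLattice ζ (2 ^ n) (M.map (aeval ζ).toLinearMap) = M.map (coefVec (2 ^ n)) := by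
  ext v
  constructor
  · rintro ⟨a, ⟨h, hh, hha⟩, rfl⟩
    refine ⟨h, hh, ?_⟩
    let w : ℚ[X] := ∑ i : Fin (2 ^ n), C (a i) * X ^ (i : ℕ)
    have hwc (j : Fin (2 ^ n)) : w.coeff j = a j := by
      simp only [w, finsetSum_coeff, coeff_C_mul_X_pow, ← Fin.ext_iff, Finset.sum_ite_eq,
        Finset.mem_univ, if_true]
    have hw : aeval ζ w = aeval ζ h := by
      rw [AlgHom.toLinearMap_apply] at hha
      rw [hha]
      simp [w]
    have hwd : w.degree < ((2 ^ n : ℕ) : WithBot ℕ) := by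
      refine (degree_sum_le _ _).trans_lt ((Finset.sup_lt_iff (WithBot.bot_lt_coe _)).2 ?_)
      intro i _
      exact (degree_C_mul_X_pow_le _ _).trans_lt (by exact_mod_cast i.2)
    have hz := eq_zero_of_aeval_eq_zero hζ (h := w - h.map (Int.castRingHom ℚ))
      ((degree_sub_le _ _).trans_lt (max_lt hwd (by rw [degree_map_intCast]; exact hM h hh)))
      (by rw [map_sub, aeval_map_intCast, hw, sub_self])
    ext i
    rw [coefVec_eq]
    simp only [intVec]
    have := congrArg (fun q => q.coeff (i : ℕ)) hz
    simp only [coeff_sub, hwc, coeff_map, coeff_zero, eq_intCast, sub_eq_zero] at this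
    rw [this]
    simp
  · rintro ⟨h, hh, rfl⟩
    refine ⟨fun i => (h.coeff i : ℚ), ⟨h, hh, ?_⟩, ?_⟩
    · rw [AlgHom.toLinearMap_apply]
      conv_lhs => rw [eq_sum_range_of_degree_lt (hM h hh)]
      rw [Finset.sum_range]
      simp
    · ext i
      simp [coefVec_eq, intVec]

theorem exists_coe_eq_aeval (y : Algebra.adjoin ℤ {ζ}) : ∃ u : ℤ[X], aeval ζ u = (y : ℂ) := by
  have hy : (y : ℂ) ∈ (aeval ζ : ℤ[X] →ₐ[ℤ] ℂ).range := by
    rw [← Algebra.adjoin_singleton_eq_range_aeval]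
    exact y.2
  exact hy

/-- The ideal `(p, F(ζ))` consists of the values at `ζ` of the multiples of `F` modulo `p`. -/
theorem aeval_mem_idealInC (hζ : IsPrimitiveRoot ζ (2 ^ (n + 1))) {p : ℕ} {F : ℤ[X]}
    (hF : F.map (Int.castRingHom (ZMod p)) ∣ X ^ 2 ^ n + 1) (h : ℤ[X]) :
    aeval ζ h ∈ idealInC (Ideal.span {(p : Algebra.adjoin ℤ {ζ}), aeval (adjoinGen ζ) F}) ↔
      F.map (Int.castRingHom (ZMod p)) ∣ h.map (Int.castRingHom (ZMod p)) := by
  have hcoe (u : ℤ[X]) : ((aeval (adjoinGen ζ) u : Algebra.adjoin ℤ {ζ}) : ℂ) = aeval ζ u :=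
    (aeval_algHom_apply (Algebra.adjoin ℤ {ζ}).val (adjoinGen ζ) u).symm
  constructor
  · rintro ⟨y, hy, hyh⟩
    obtain ⟨a, b, hab⟩ := Ideal.mem_span_pair.1 hy
    obtain ⟨u, hu⟩ := exists_coe_eq_aeval a
    obtain ⟨v, hv⟩ := exists_coe_eq_aeval b
    have h0 : aeval ζ (h - (u * (p : ℤ[X]) + v * F)) = 0 := by
      have e : (y : ℂ) = aeval ζ h := hyh
      rw [map_sub, ← e, ← hab]
      simp [← hu, ← hv, hcoe]
    -- Evaluation at `ζ` has kernel generated by `X ^ 2 ^ n + 1`, a multiple of `F` modulo `p`; so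
    -- the choice of representatives does not affect divisibility by `F`.
    rw [aeval_eq_zero_iff_of_isPrimitiveRoot_two_pow hζ] at h0
    have h1 := Polynomial.map_dvd (Int.castRingHom (ZMod p)) h0
    simp only [Polynomial.map_add, Polynomial.map_sub, Polynomial.map_mul, Polynomial.map_pow,
      Polynomial.map_X, Polynomial.map_one, Polynomial.map_natCast, CharP.cast_eq_zero, mul_zero,
      zero_add] at h1
    exact (dvd_sub_left (dvd_mul_left _ _)).1 (hF.trans h1)
  · rintro ⟨q, hq⟩
    obtain ⟨v, rfl⟩ := Polynomial.map_surjective (Int.castRingHom (ZMod p)) ZMod.intCast_surjective q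
    have hz : (h - F * v).map (Int.castRingHom (ZMod p)) = 0 := by
      rw [Polynomial.map_sub, Polynomial.map_mul, hq, sub_self]
    have hp : C (p : ℤ) ∣ h - F * v := by
      rw [C_dvd_iff_dvd_coeff]
      intro i
      rw [← ZMod.intCast_zmod_eq_zero_iff_dvd]
      simpa only [coeff_map, eq_intCast, coeff_zero] using congrArg (fun q => coeff q i) hz
    obtain ⟨u, hu⟩ := hp
    refine ⟨aeval (adjoinGen ζ) u * p + aeval (adjoinGen ζ) v * aeval (adjoinGen ζ) F,
      Ideal.mem_span_pair.2 ⟨_, _, rfl⟩, ?_⟩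
    have : h = u * (p : ℤ[X]) + v * F := by
      rw [eq_intCast C, Int.cast_natCast] at hu
      linear_combination hu
    rw [this]
    simp [hcoe]

theorem idealInC_eq_map (hζ : IsPrimitiveRoot ζ (2 ^ (n + 1))) {p : ℕ} {F : ℤ[X]}
    (hF : F.map (Int.castRingHom (ZMod p)) ∣ X ^ 2 ^ n + 1) :
    idealInC (Ideal.span {(p : Algebra.adjoin ℤ {ζ}), aeval (adjoinGen ζ) F}) =
      (polyLattice p (2 ^ n) (F.map (Int.castRingHom (ZMod p)))).map (aeval ζ).toLinearMap := by
  ext x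
  constructor
  · intro hx
    obtain ⟨y, -, hyx⟩ := id hx
    obtain ⟨u, hu⟩ := exists_coe_eq_aeval y
    have hmon := monic_X_pow_two_pow_add_one ℤ n
    have hmod : aeval ζ (u %ₘ (X ^ 2 ^ n + 1)) = aeval ζ u := by
      conv_rhs => rw [← modByMonic_add_div u (X ^ 2 ^ n + 1)]
      rw [map_add, map_mul, (aeval_eq_zero_iff_of_isPrimitiveRoot_two_pow hζ _).2 dvd_rfl,
        zero_mul, add_zero]
    have hxu : aeval ζ (u %ₘ (X ^ 2 ^ n + 1)) = x := hmod.trans (hu.trans hyx)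
    refine ⟨u %ₘ (X ^ 2 ^ n + 1), ⟨?_, ?_⟩, hxu⟩
    · rw [← degree_X_pow_two_pow_add_one ℤ n]
      exact degree_modByMonic_lt u hmon
    · exact (aeval_mem_idealInC hζ hF _).1 (hxu ▸ hx)
  · rintro ⟨h, hh, rfl⟩
    exact (aeval_mem_idealInC hζ hF h).2 hh.2

theorem mem_integersInC {K : IntermediateField ℚ ℂ} {x : ℂ} :
    x ∈ integersInC K ↔ x ∈ K ∧ IsIntegral ℤ x := by
  constructor
  · rintro ⟨y, rfl⟩
    refine ⟨(y : K).2, ?_⟩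
    exact (RingOfIntegers.isIntegral y).map (IsScalarTower.toAlgHom ℤ (𝓞 K) ℂ)
  · rintro ⟨hx, hi⟩
    have : IsIntegral ℤ (⟨x, hx⟩ : K) :=
      (isIntegral_algHom_iff (IsScalarTower.toAlgHom ℤ K ℂ) (algebraMap K ℂ).injective).1 hi
    exact ⟨⟨⟨x, hx⟩, this⟩, rfl⟩

end Cyclotomic

/-! ### Contraction to the subfield and the direct sum. -/

section Subfield

variable {n r : ℕ} {ζ : ℂ}

theorem two_pow_mul_two_pow_sub (hr : r ≤ n) : 2 ^ r * 2 ^ (n - r) = 2 ^ n := by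
  rw [← pow_add]; congr 1; omega

theorem isPrimitiveRoot_pow_two_pow_sub (hζ : IsPrimitiveRoot ζ (2 ^ (n + 1))) (hr : r ≤ n) :
    IsPrimitiveRoot (ζ ^ 2 ^ (n - r)) (2 ^ (r + 1)) := by
  refine hζ.pow (by positivity) ?_
  rw [← pow_add]; congr 1; omega

theorem exists_aeval_expand_of_mem_adjoin (hζ : IsPrimitiveRoot ζ (2 ^ (n + 1))) (hr : r ≤ n)
    {x : ℂ} (hx : x ∈ IntermediateField.adjoin ℚ {ζ ^ 2 ^ (n - r)}) :
    ∃ w : ℚ[X], w.degree < ((2 ^ r : ℕ) : WithBot ℕ) ∧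
      aeval ζ (expand ℚ (2 ^ (n - r)) w) = x := by
  have hη := isPrimitiveRoot_pow_two_pow_sub hζ hr
  have hint : IsIntegral ℚ (ζ ^ 2 ^ (n - r)) := (hη.isIntegral (by positivity)).tower_top
  rw [← IntermediateField.mem_toSubalgebra,
    IntermediateField.adjoin_simple_toSubalgebra_of_isAlgebraic hint.isAlgebraic,
    Algebra.adjoin_singleton_eq_range_aeval] at hx
  obtain ⟨u, rfl⟩ := hx
  refine ⟨u %ₘ minpoly ℚ (ζ ^ 2 ^ (n - r)), ?_, ?_⟩
  · have := degree_modByMonic_lt u (minpoly.monic hint)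
    refine this.trans_eq ?_
    rw [minpoly_rat_of_isPrimitiveRoot_two_pow hη, degree_X_pow_two_pow_add_one]
  · rw [expand_aeval, minpoly.aeval_modByMonic_minpoly]
    rfl

/-- The contraction of the ideal `(p, F(ζ))` to the subfield, where `F` is `g(X ^ S)` modulo `p`. -/
theorem idealInC_inf_integersInC (hζ : IsPrimitiveRoot ζ (2 ^ (n + 1))) (hr : r ≤ n) {p : ℕ}
    {F : ℤ[X]} {g : (ZMod p)[X]} (hg : g ∣ X ^ 2 ^ r + 1)
    (hFg : F.map (Int.castRingHom (ZMod p)) = expand (ZMod p) (2 ^ (n - r)) g)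
    (hF : F.map (Int.castRingHom (ZMod p)) ∣ X ^ 2 ^ n + 1) :
    idealInC (Ideal.span {(p : Algebra.adjoin ℤ {ζ}), aeval (adjoinGen ζ) F}) ⊓
        integersInC (IntermediateField.adjoin ℚ {ζ ^ 2 ^ (n - r)}) =
      ((polyLattice p (2 ^ r) g).map (expand ℤ (2 ^ (n - r))).toLinearMap).map
        (aeval ζ).toLinearMap := by
  have hS : 0 < 2 ^ (n - r) := by positivity
  have hint : IsIntegral ℤ ζ := hζ.isIntegral (by positivity)
  ext x
  rw [Submodule.mem_inf, mem_integersInC]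
  constructor
  · rintro ⟨hxP, hxK, -⟩
    rw [idealInC_eq_map hζ hF] at hxP
    obtain ⟨h, ⟨hd, hdvd⟩, rfl⟩ := hxP
    obtain ⟨w, hwd, hw⟩ := exists_aeval_expand_of_mem_adjoin hζ hr hxK
    have hz := eq_zero_of_aeval_eq_zero hζ
      (h := h.map (Int.castRingHom ℚ) - expand ℚ (2 ^ (n - r)) w)
      ((degree_sub_le _ _).trans_lt (max_lt (by rwa [degree_map_intCast]) (by
        rw [← two_pow_mul_two_pow_sub hr]
        exact degree_expand_lt hS hwd)))
      (by rw [map_sub, aeval_map_intCast, hw, AlgHom.toLinearMap_apply, sub_self])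
    -- Membership in the ideal gives integral coefficients, and membership in `K` gives an expansion
    -- in powers of `ζ ^ S`. By uniqueness of expansions `h` involves only exponents divisible by
    -- `S`. An integral basis of `O_K` is never needed.
    have hexp : expand ℤ (2 ^ (n - r)) (sect (2 ^ (n - r)) 0 h) = h := by
      ext i
      rw [coeff_expand hS]
      split_ifs with hi
      · rw [coeff_sect hS, zero_add, Nat.div_mul_cancel hi]
      · have := congrArg (fun q => q.coeff i) hz
        simp only [coeff_sub, coeff_map, coeff_expand hS, hi, if_false, sub_zero, coeff_zero,
          eq_intCast, Int.cast_eq_zero] at this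
        exact this.symm
    refine ⟨h, ⟨sect (2 ^ (n - r)) 0 h, ⟨?_, ?_⟩, hexp⟩, rfl⟩
    · exact degree_sect_lt hS 0 (by rwa [two_pow_mul_two_pow_sub hr])
    · rw [map_sect _ hS]
      exact dvd_sect_of_expand_dvd hS (isCoprime_X_of_dvd_X_pow_add_one (by positivity) hg)
        (hFg ▸ hdvd) hS
  · rintro ⟨_, ⟨h, ⟨hd, hdvd⟩, rfl⟩, rfl⟩
    refine ⟨?_, ?_, ?_⟩
    · refine (aeval_mem_idealInC hζ hF _).2 ?_
      rw [hFg, AlgHom.toLinearMap_apply, ← AlgHom.coe_toRingHom]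
      exact (map_expand (f := Int.castRingHom (ZMod p)) (q := h)) ▸ _root_.map_dvd _ hdvd
    · simp only [AlgHom.toLinearMap_apply, expand_aeval]
      have : aeval (ζ ^ 2 ^ (n - r)) (h.map (Int.castRingHom ℚ)) ∈
          Algebra.adjoin ℚ {ζ ^ 2 ^ (n - r)} := aeval_mem_adjoin_singleton _ _
      rw [aeval_map_intCast] at this
      exact IntermediateField.algebra_adjoin_le_adjoin _ _ this
    · simp only [AlgHom.toLinearMap_apply]
      exact adjoin_le_integralClosure hint (aeval_mem_adjoin_singleton _ _)

/-- Multiplying the contraction by the powers of `ζ` gives a direct sum. -/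
theorem iSupIndep_map_mulLeft (hζ : IsPrimitiveRoot ζ (2 ^ (n + 1))) (hr : r ≤ n)
    (M : Submodule ℤ ℤ[X]) (hM : ∀ h ∈ M, h.degree < ((2 ^ r : ℕ) : WithBot ℕ)) :
    iSupIndep fun j : Fin (2 ^ (n - r)) =>
      ((M.map (expand ℤ (2 ^ (n - r))).toLinearMap).map (aeval ζ).toLinearMap).map
        (LinearMap.mulLeft ℤ (ζ ^ (j : ℕ))) := by
  rw [iSupIndep_iff_finsetSum_eq_zero_imp_eq_zero]
  intro s v hv hsum
  have hv' (i : Fin (2 ^ (n - r))) : ∃ h : ℤ[X], i ∈ s →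
      h.degree < ((2 ^ r : ℕ) : WithBot ℕ) ∧
        v i = aeval ζ (X ^ (i : ℕ) * expand ℤ (2 ^ (n - r)) h) := by
    by_cases hi : i ∈ s
    · obtain ⟨_, ⟨_, ⟨h, hh, rfl⟩, rfl⟩, hvi⟩ := hv i hi
      refine ⟨h, fun _ => ⟨hM h hh, ?_⟩⟩
      rw [← hvi]
      simp
    · exact ⟨0, fun h => absurd h hi⟩
  choose h hh using hv'
  have hz : ∑ i ∈ s, X ^ (i : ℕ) * expand ℤ (2 ^ (n - r)) (h i) = 0 := by
    refine eq_zero_of_aeval_int_eq_zero hζ ?_ ?_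
    · refine (degree_sum_le _ _).trans_lt ((Finset.sup_lt_iff (WithBot.bot_lt_coe _)).2 ?_)
      intro i hi
      rw [← two_pow_mul_two_pow_sub hr]
      exact degree_X_pow_mul_expand_lt i.2 (hh i hi).1
    · rw [map_sum, ← hsum]
      exact Finset.sum_congr rfl fun i hi => (hh i hi).2.symm
  intro i hi
  have : h i = 0 := by
    ext j
    -- The exponents in the residue class of `i` occur in the `i`-th summand only.
    have := congrArg (fun q => q.coeff (i + j * 2 ^ (n - r))) hz
    simp only [finsetSum_coeff, coeff_zero] at this
    rw [coeff_zero, ← this, Finset.sum_eq_single i]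
    · rw [coeff_X_pow_mul_expand _ i.2 i.2, if_pos rfl]
    · intro k _ hki
      rw [coeff_X_pow_mul_expand _ k.2 i.2, if_neg (fun e => hki (Fin.ext e))]
    · exact fun hn => absurd hi hn
  rw [(hh i hi).2, this]
  simp

theorem iSup_map_mulLeft (hζ : IsPrimitiveRoot ζ (2 ^ (n + 1))) (hr : r ≤ n) {p : ℕ}
    {F : ℤ[X]} {g : (ZMod p)[X]} (hg : g ∣ X ^ 2 ^ r + 1)
    (hFg : F.map (Int.castRingHom (ZMod p)) = expand (ZMod p) (2 ^ (n - r)) g)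
    (hF : F.map (Int.castRingHom (ZMod p)) ∣ X ^ 2 ^ n + 1) :
    ⨆ j : Fin (2 ^ (n - r)),
      (((polyLattice p (2 ^ r) g).map (expand ℤ (2 ^ (n - r))).toLinearMap).map
        (aeval ζ).toLinearMap).map (LinearMap.mulLeft ℤ (ζ ^ (j : ℕ))) =
      idealInC (Ideal.span {(p : Algebra.adjoin ℤ {ζ}), aeval (adjoinGen ζ) F}) := by
  have hS : 0 < 2 ^ (n - r) := by positivity
  apply le_antisymm
  · refine iSup_le fun j => ?_
    rintro _ ⟨_, ⟨_, ⟨h, ⟨hd, hdvd⟩, rfl⟩, rfl⟩, rfl⟩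
    have : F.map (Int.castRingHom (ZMod p)) ∣
        (X ^ (j : ℕ) * expand ℤ (2 ^ (n - r)) h).map (Int.castRingHom (ZMod p)) := by
      rw [Polynomial.map_mul, map_expand, hFg]
      exact (_root_.map_dvd (expand (ZMod p) (2 ^ (n - r))) hdvd).mul_left _
    have := (aeval_mem_idealInC hζ hF _).2 this
    simpa using this
  · rw [idealInC_eq_map hζ hF]
    rintro _ ⟨h, ⟨hd, hdvd⟩, rfl⟩
    rw [← sum_sect hS h, map_sum]
    refine Submodule.sum_mem _ fun k hk => ?_
    rw [Finset.mem_range] at hk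
    refine Submodule.mem_iSup_of_mem (⟨k, hk⟩ : Fin (2 ^ (n - r))) ?_
    refine ⟨_, ⟨_, ⟨sect (2 ^ (n - r)) k h, ⟨?_, ?_⟩, rfl⟩, rfl⟩, ?_⟩
    · exact degree_sect_lt hS k (by rwa [two_pow_mul_two_pow_sub hr])
    · rw [map_sect _ hS]
      exact dvd_sect_of_expand_dvd hS (isCoprime_X_of_dvd_X_pow_add_one (by positivity) hg)
        (hFg ▸ hdvd) hk
    · simp

end Subfield

/-! ### Shortest vectors of the two lattices. -/

section Lattices

variable {S D p : ℕ} {g : (ZMod p)[X]}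

/-- A nonzero vector of the large lattice is at least as long as some nonzero vector of the
small one. -/
theorem exists_mem_polyLattice_norm_le (hS : 0 < S) (hX : IsCoprime g X)
    {w : EuclideanSpace ℝ (Fin (D * S))}
    (hw : w ∈ (polyLattice p (D * S) (expand (ZMod p) S g)).map (coefVec (D * S))) (hw0 : w ≠ 0) :
    ∃ h ∈ polyLattice p D g, h ≠ 0 ∧ ‖coefVec D h‖ ≤ ‖w‖ := by
  obtain ⟨h, ⟨hd, hdvd⟩, rfl⟩ := hw
  have : ∃ k < S, sect S k h ≠ 0 := by
    by_contra! hcon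
    apply hw0
    rw [← sum_sect hS h, Finset.sum_eq_zero, map_zero]
    intro k hk
    rw [hcon k (Finset.mem_range.1 hk)]
    simp
  obtain ⟨k, hk, hne⟩ := this
  refine ⟨sect S k h, ⟨degree_sect_lt hS k hd, ?_⟩, hne, norm_coefVec_sect_le hS hk h⟩
  rw [map_sect _ hS]
  exact dvd_sect_of_expand_dvd hS hX hdvd hk

theorem expand_mem_polyLattice (hS : 0 < S) {h : ℤ[X]} (hh : h ∈ polyLattice p D g) :
    expand ℤ S h ∈ polyLattice p (D * S) (expand (ZMod p) S g) := by
  refine ⟨degree_expand_lt hS hh.1, ?_⟩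
  rw [map_expand]
  exact _root_.map_dvd (expand (ZMod p) S) hh.2

theorem coefVec_ne_zero {h : ℤ[X]} (hd : h.degree < (D : WithBot ℕ)) (h0 : h ≠ 0) :
    coefVec D h ≠ 0 := by
  intro e
  exact h0 (coefVec_injOn hd (by simp) (e.trans (map_zero _).symm))

theorem lambda1_map_polyLattice_expand (hS : 0 < S) (hX : IsCoprime g X) (hne : polyLattice p D g ≠ ⊥) :
    lambda1 ((polyLattice p (D * S) (expand (ZMod p) S g)).map (coefVec (D * S))) =
      lambda1 (((polyLattice p D g).map (expand ℤ S).toLinearMap).map (coefVec (D * S))) := by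
  have hbdd (Λ : Submodule ℤ (EuclideanSpace ℝ (Fin (D * S)))) :
      BddBelow {x : ℝ | ∃ v ∈ Λ, v ≠ 0 ∧ x = ‖v‖} :=
    ⟨0, by rintro _ ⟨v, -, -, rfl⟩; exact norm_nonneg v⟩
  have hmem {h : ℤ[X]} (hh : h ∈ polyLattice p D g) (h0 : h ≠ 0) :
      ∃ v ∈ ((polyLattice p D g).map (expand ℤ S).toLinearMap).map (coefVec (D * S)),
        v ≠ 0 ∧ ‖coefVec D h‖ = ‖v‖ :=
    ⟨_, ⟨_, ⟨h, hh, rfl⟩, rfl⟩, coefVec_ne_zero (degree_expand_lt hS hh.1)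
      ((expand_ne_zero hS).2 h0), (norm_coefVec_expand hS h).symm⟩
  -- Comparing the real infima requires the sets of lengths to be nonempty.
  obtain ⟨h, hh, h0⟩ := Submodule.exists_mem_ne_zero_of_ne_bot hne
  apply le_antisymm
  · refine csInf_le_csInf (hbdd _) ⟨_, hmem hh h0⟩ ?_
    rintro _ ⟨_, ⟨_, ⟨h, hh, rfl⟩, rfl⟩, hv, rfl⟩
    exact ⟨_, ⟨_, expand_mem_polyLattice hS hh, rfl⟩, hv, rfl⟩
  · refine le_csInf ⟨_, _, ⟨_, expand_mem_polyLattice hS hh, rfl⟩, coefVec_ne_zero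
      (degree_expand_lt hS hh.1) ((expand_ne_zero hS).2 h0), rfl⟩ ?_
    rintro _ ⟨w, hw, hw0, rfl⟩
    obtain ⟨h, hh, h0, hle⟩ := exists_mem_polyLattice_norm_le hS hX hw hw0
    exact (csInf_le (hbdd _) (hmem hh h0)).trans hle

/-- Spacing out the coefficients preserves the norm, and every competitor has a nonzero section that
is no longer than itself. This turns the oracle's answer into the output. -/
theorem isShortestVector_expand (hS : 0 < S) (hX : IsCoprime g X) {h : ℤ[X]}
    (hd : h.degree < (D : WithBot ℕ))
    (hs : IsShortestVector ((polyLattice p D g).map (coefVec D)) (coefVec D h)) :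
    IsShortestVector ((polyLattice p (D * S) (expand (ZMod p) S g)).map (coefVec (D * S)))
      (coefVec (D * S) (expand ℤ S h)) := by
  obtain ⟨⟨h', hh', e⟩, h0, hmin⟩ := hs
  obtain rfl := coefVec_injOn hh'.1 hd e
  refine ⟨⟨_, expand_mem_polyLattice hS hh', rfl⟩, ?_, ?_⟩
  · refine coefVec_ne_zero (degree_expand_lt hS hd) ((expand_ne_zero hS).2 ?_)
    rintro rfl
    exact h0 (map_zero _)
  · intro w hw hw0
    obtain ⟨u, hu, hu0, hle⟩ := exists_mem_polyLattice_norm_le hS hX hw hw0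
    rw [norm_coefVec_expand hS]
    exact (hmin _ ⟨u, hu, rfl⟩ (coefVec_ne_zero hu.1 hu0)).trans hle

theorem finrank_map_expand_polyLattice (hS : 0 < S) :
    Module.finrank ℤ (((polyLattice p D g).map (expand ℤ S).toLinearMap).map (coefVec (D * S))) =
      Module.finrank ℤ (polyLattice p D g) := by
  rw [← Submodule.map_comp, ← LinearMap.range_domRestrict]
  apply LinearMap.finrank_range_of_inj
  rintro ⟨a, ha⟩ ⟨b, hb⟩ hab
  have := coefVec_injOn (degree_expand_lt hS ha.1) (degree_expand_lt hS hb.1) hab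
  exact Subtype.ext (expand_injective hS this)

end Lattices

/-! ### A cost calculus for programs -/

theorem bitLen_le_iff {z : ℤ} {L : ℕ} : bitLen z ≤ L ↔ z.natAbs < 2 ^ L := Nat.size_le

theorem bitLen_natCast_le {m L : ℕ} (h : m < 2 ^ L) : bitLen (m : ℤ) ≤ L :=
  bitLen_le_iff.2 (by simpa using h)

theorem bitLen_mono {y z : ℤ} (h : y.natAbs ≤ z.natAbs) : bitLen y ≤ bitLen z :=
  Nat.size_le_size h

theorem natAbs_lt_two_pow_bitLen (z : ℤ) : z.natAbs < 2 ^ bitLen z := Nat.lt_size_self _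

theorem bitLen_eval_binOp (o : BinOp) (x y : ℤ) : bitLen (o.eval x y) ≤ bitLen x + bitLen y + 1 := by
  have hx := natAbs_lt_two_pow_bitLen x
  have hy := natAbs_lt_two_pow_bitLen y
  have hadd {z : ℤ} (hz : z.natAbs ≤ x.natAbs + y.natAbs) : bitLen z ≤ bitLen x + bitLen y + 1 := by
    rw [bitLen_le_iff]
    have h1 : 2 ^ bitLen x ≤ 2 ^ (bitLen x + bitLen y) := Nat.pow_le_pow_right (by omega) (by omega)
    have h2 : 2 ^ bitLen y ≤ 2 ^ (bitLen x + bitLen y) := Nat.pow_le_pow_right (by omega) (by omega)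
    rw [pow_succ]
    omega
  cases o with
  | add => exact hadd (Int.natAbs_add_le x y)
  | sub => exact hadd (Int.natAbs_sub_le x y)
  | mul =>
    refine (bitLen_le_iff (L := bitLen x + bitLen y)).2 ?_ |>.trans (Nat.le_succ _)
    simp only [BinOp.eval, Int.natAbs_mul]
    rw [pow_add]
    exact Nat.mul_lt_mul'' hx hy
  | div => exact hadd ((Int.natAbs_ediv_le_natAbs x y).trans (Nat.le_add_right _ _))
  | mod =>
    refine hadd ?_
    simp only [BinOp.eval]
    -- `x % 0 = x`, so the bound by `|y|` fails there and the bound by `|x|` takes over.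
    rcases eq_or_ne y 0 with rfl | h0
    · simp
    · have h1 := Int.emod_nonneg x h0
      have h2 := Int.emod_lt_abs x h0
      rw [Int.abs_eq_natAbs] at h2
      omega

/-- All memory cells hold integers of bit length at most `L`. -/
def MemBdd (L : ℕ) (s : Mem) : Prop := ∀ a i, bitLen (s a i) ≤ L

theorem MemBdd.set {L : ℕ} {s : Mem} (h : MemBdd L s) (a i : ℕ) {z : ℤ} (hz : bitLen z ≤ L) :
    MemBdd L (s.set a i z) := by
  intro a' i'
  simp only [Mem.set]
  split_ifs
  · exact hz
  · exact h a' i'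

/-- A syntactic size of expressions. -/
def Expr.len : Expr → ℕ
  -- Counting a literal by its absolute value makes `len` an upper bound for its bit length.
  | .lit z => z.natAbs + 1
  | .get _ i => i.len + 1
  | .op _ x y => x.len + y.len + 1

theorem Expr.one_le_len (e : Expr) : 1 ≤ e.len := by
  cases e <;> simp [Expr.len]

theorem bitLen_le_natAbs (z : ℤ) : bitLen z ≤ z.natAbs :=
  bitLen_le_iff.2 Nat.lt_two_pow_self

theorem Expr.bitLen_eval_le {L : ℕ} {s : Mem} (hs : MemBdd L s) (e : Expr) :
    bitLen (e.eval s) ≤ e.len * (L + 1) := by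
  induction e with
  | lit z =>
    have := bitLen_le_natAbs z
    simp only [Expr.eval, Expr.len]
    nlinarith
  | get a i ih =>
    have := hs a (i.eval s).toNat
    simp only [Expr.eval, Expr.len]
    nlinarith
  | op o x y hx hy =>
    have := bitLen_eval_binOp o (x.eval s) (y.eval s)
    simp only [Expr.eval, Expr.len]
    nlinarith

/-- The factor 2 makes the induction close: with `a, b ≥ 1` bounding the operand lengths, `2 * a ^ 2
+ 2 * b ^ 2 + (1 + a) * (1 + b) ≤ 2 * (a + b) ^ 2`. -/
theorem Expr.cost_le {L : ℕ} {s : Mem} (hs : MemBdd L s) (e : Expr) :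
    e.cost s ≤ 2 * (e.len * (L + 1)) ^ 2 := by
  induction e with
  | lit z =>
    have := bitLen_le_natAbs z
    simp only [Expr.cost, Expr.len]
    nlinarith [Nat.zero_le ((z.natAbs + 1) * L)]
  | get a i ih =>
    have h1 := hs a (i.eval s).toNat
    have h2 := i.bitLen_eval_le hs
    have h3 := i.one_le_len
    simp only [Expr.cost, Expr.len]
    have : (i.len + 1) * (L + 1) = i.len * (L + 1) + (L + 1) := by ring
    rw [this]
    nlinarith [Nat.zero_le (i.len * (L + 1) * L)]
  | op o x y hx hy =>
    have h1 := x.bitLen_eval_le hs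
    have h2 := y.bitLen_eval_le hs
    have h3 := x.one_le_len
    have h4 := y.one_le_len
    have h5 : 1 ≤ x.len * (L + 1) := Nat.mul_pos h3 (by omega)
    have h6 : 1 ≤ y.len * (L + 1) := Nat.mul_pos h4 (by omega)
    simp only [Expr.cost, Expr.len]
    have h7 : (1 + bitLen (x.eval s)) * (1 + bitLen (y.eval s)) ≤
        (2 * (x.len * (L + 1))) * (2 * (y.len * (L + 1))) :=
      Nat.mul_le_mul (by omega) (by omega)
    have h8 : (x.len * (L + 1) + y.len * (L + 1)) ^ 2 ≤ ((x.len + y.len + 1) * (L + 1)) ^ 2 :=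
      Nat.pow_le_pow_left (by nlinarith) 2
    nlinarith

/-- A bound for the cost of a single step on memory of bit length at most `L`, in a program whose
expressions have size at most `K`. -/
def stepCost (K L : ℕ) : ℕ := 10 * (K * (L + 1)) ^ 2

section Runs

variable {D : ℕ} {O : Matrix (Fin D) (Fin D) ℤ → Fin D → ℤ} {U K L : ℕ}

/-- Started on `s`, the program `c` halts at cost at most `T * U` on a memory that
satisfies `Q`. -/
def Runs (O : Matrix (Fin D) (Fin D) ℤ → Fin D → ℤ) (U : ℕ) (c : Prog) (s : Mem)
    (Q : Mem → Prop) (T : ℕ) : Prop :=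
  ∃ s' t, Exec O c s s' t ∧ t ≤ T * U ∧ Q s'

theorem Runs.mono {c : Prog} {s : Mem} {Q Q' : Mem → Prop} {T T' : ℕ} (h : Runs O U c s Q T)
    (hQ : ∀ s', Q s' → Q' s') (hT : T ≤ T') : Runs O U c s Q' T' := by
  obtain ⟨s', t, he, ht, hq⟩ := h
  exact ⟨s', t, he, ht.trans (Nat.mul_le_mul_right U hT), hQ s' hq⟩

theorem Runs.seq {c d : Prog} {s : Mem} {Q R : Mem → Prop} {T T' : ℕ} (hU : 1 ≤ U)
    (h : Runs O U c s R T) (h' : ∀ s', R s' → Runs O U d s' Q T') :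
    Runs O U (.seq c d) s Q (T + T' + 1) := by
  obtain ⟨s', t, he, ht, hr⟩ := h
  obtain ⟨s'', u, he', hu, hq⟩ := h' s' hr
  refine ⟨s'', _, .seq he he', ?_, hq⟩
  nlinarith

theorem one_le_stepCost (hK : 1 ≤ K) : 1 ≤ stepCost K L := by
  have : 1 ≤ K * (L + 1) := Nat.mul_pos hK (by omega)
  have : 1 ≤ (K * (L + 1)) ^ 2 := Nat.one_le_pow _ _ this
  unfold stepCost
  omega

theorem Runs.skip {s : Mem} {Q : Mem → Prop} (hU : 1 ≤ U) (hQ : Q s) :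
    Runs O U .skip s Q 1 :=
  ⟨s, 1, .skip s, by omega, hQ⟩

theorem Expr.cost_le_of_len_le {e : Expr} {s : Mem} (hs : MemBdd L s) (he : e.len ≤ K) :
    e.cost s ≤ 2 * (K * (L + 1)) ^ 2 :=
  (e.cost_le hs).trans (Nat.mul_le_mul_left 2
    (Nat.pow_le_pow_left (Nat.mul_le_mul_right _ he) 2))

theorem Expr.one_add_cost_le {e : Expr} {s : Mem} (hs : MemBdd L s) (he : e.len ≤ K) :
    1 + e.cost s ≤ stepCost K L := by
  have h1 := Expr.cost_le_of_len_le hs he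
  have h2 := one_le_stepCost (L := L) (e.one_le_len.trans he)
  unfold stepCost at *
  omega

theorem Runs.set {s : Mem} {a : ℕ} {i e : Expr} {Q : Mem → Prop} (j : ℕ) (z : ℤ)
    (hs : MemBdd L s) (hi : i.len ≤ K) (he : e.len ≤ K) (hj : (i.eval s).toNat = j)
    (hz : e.eval s = z) (hQ : Q (s.set a j z)) : Runs O (stepCost K L) (.set a i e) s Q 1 := by
  subst hj hz
  refine ⟨_, _, .set s a i e, ?_, hQ⟩
  have h1 := Expr.cost_le_of_len_le hs hi
  have h2 := Expr.cost_le_of_len_le hs he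
  have h3 := (i.bitLen_eval_le hs).trans (Nat.mul_le_mul_right (L + 1) hi)
  have h4 := (e.bitLen_eval_le hs).trans (Nat.mul_le_mul_right (L + 1) he)
  have h5 : 1 ≤ K * (L + 1) := Nat.mul_pos (i.one_le_len.trans hi) (by omega)
  unfold stepCost
  nlinarith

theorem Runs.ite {s : Mem} {e : Expr} {c d : Prog} {Q : Mem → Prop} {T : ℕ} (hs : MemBdd L s)
    (he : e.len ≤ K) (hc : 0 < e.eval s → Runs O (stepCost K L) c s Q T)
    (hd : ¬ 0 < e.eval s → Runs O (stepCost K L) d s Q T) :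
    Runs O (stepCost K L) (.ite e c d) s Q (T + 1) := by
  have := Expr.one_add_cost_le hs he
  by_cases h : 0 < e.eval s
  · obtain ⟨s', t, hx, ht, hq⟩ := hc h
    exact ⟨s', _, .iteTrue h hx, by rw [add_mul, one_mul]; omega, hq⟩
  · obtain ⟨s', t, hx, ht, hq⟩ := hd h
    exact ⟨s', _, .iteFalse h hx, by rw [add_mul, one_mul]; omega, hq⟩

/-- The index of `Inv` bounds the number of iterations left. The loop may stop before it reaches 0,
as modular exponentiation does, hence the existential in the postcondition. -/
theorem Runs.loop {e : Expr} {c : Prog} {Inv : ℕ → Mem → Prop} {T : ℕ}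
    (hs : ∀ k s, Inv k s → MemBdd L s) (he : e.len ≤ K)
    (h0 : ∀ s, Inv 0 s → ¬ 0 < e.eval s)
    (hstep : ∀ k s, Inv (k + 1) s → 0 < e.eval s → Runs O (stepCost K L) c s (Inv k) T)
    (k : ℕ) : ∀ s, Inv k s → Runs O (stepCost K L) (.loop e c) s
      (fun s' => ∃ k, Inv k s' ∧ ¬ 0 < e.eval s') (k * (T + 1) + 1) := by
  induction k with
  | zero =>
    intro s h
    have := Expr.one_add_cost_le (hs 0 s h) he
    exact ⟨s, _, .loopStop (h0 s h), by simpa using this, 0, h, h0 s h⟩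
  | succ k ih =>
    intro s h
    have h1 := Expr.one_add_cost_le (hs _ s h) he
    by_cases hpos : 0 < e.eval s
    · obtain ⟨s', t, hx, ht, hq⟩ := hstep k s h hpos
      obtain ⟨s'', u, hx', hu, hq'⟩ := ih s' hq
      exact ⟨s'', _, .loopStep hpos hx hx', by nlinarith, hq'⟩
    · refine ⟨s, _, .loopStop hpos, h1.trans ?_, k + 1, h, hpos⟩
      exact Nat.le_mul_of_pos_left _ (by omega)

theorem Runs.call {s : Mem} {q b : ℕ} {Q : Mem → Prop} (hK : 1 ≤ K) (hs : MemBdd L s)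
    (hO : ∀ j, bitLen (O (s.matrix D q) j) ≤ L) (hQ : Q (s.setVec b (O (s.matrix D q)))) :
    Runs O (stepCost K L) (.call q b) s Q (1 + D * D + D) := by
  refine ⟨_, _, .call s q b, ?_, hQ⟩
  have hU : 1 + L ≤ stepCost K L := by
    unfold stepCost
    have : 1 + L ≤ K * (L + 1) := by nlinarith
    nlinarith
  have h1 : ∑ i, ∑ j, (1 + bitLen (s.matrix D q i j)) ≤ D * D * stepCost K L := by
    have : ∀ i ∈ Finset.univ, ∑ j, (1 + bitLen (s.matrix D q i j)) ≤ D * stepCost K L := by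
      intro i _
      refine (Finset.sum_le_card_nsmul _ _ (stepCost K L) fun j _ => ?_).trans_eq (by simp)
      exact (Nat.add_le_add_left (hs _ _) 1).trans hU
    refine (Finset.sum_le_card_nsmul _ _ _ this).trans_eq ?_
    simp [mul_assoc]
  have h2 : ∑ j, (1 + bitLen (O (s.matrix D q) j)) ≤ D * stepCost K L := by
    refine (Finset.sum_le_card_nsmul _ _ (stepCost K L) fun j _ => ?_).trans_eq (by simp)
    exact (Nat.add_le_add_left (hO _) 1).trans hU
  have h3 := one_le_stepCost (L := L) hK
  nlinarith

theorem MemBdd.setVec {s : Mem} (h : MemBdd L s) (b : ℕ) {v : Fin D → ℤ}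
    (hv : ∀ j, bitLen (v j) ≤ L) : MemBdd L (s.setVec b v) := by
  intro a i
  simp only [Mem.setVec]
  split_ifs
  · exact hv _
  · exact h a i

end Runs

/-! ### The program -/

namespace Prog

/-- The scalar variable stored in array `a`. -/
def var (a : ℕ) : Expr := .get a (.lit 0)

/-- Assignment to a scalar variable. -/
def assign (a : ℕ) (e : Expr) : Prog := .set a (.lit 0) e

/-- Decrement of the loop counter. -/
def decr : Prog := assign 8 (.op .sub (var 8) (.lit 1))

/-- Initialize variable `5` to `(p - 1) / 2` or `p + 1`, according to `p` modulo `4`, variables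
`6` and `7` to `1`, and the counter to `n`. -/
def initSplit : Prog :=
  .seq (assign 6 (.lit 1)) <| .seq (assign 7 (.lit 1)) <| .seq (assign 8 (var 0)) <|
    -- For odd `p` the test succeeds exactly when `p % 4 = 3`. The number stored is `2 ^ A * m` or
    -- `2 ^ (A - 1) * m`, so the minimum of its 2-adic valuation and `n` is `r`.
    .ite (.op .sub (.op .mod (.get 0 (.lit 1)) (.lit 4)) (.lit 1))
      (assign 5 (.op .add (.get 0 (.lit 1)) (.lit 1)))
      (assign 5 (.op .div (.op .sub (.get 0 (.lit 1)) (.lit 1)) (.lit 2)))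

/-- The body of `splitLoop`. -/
def splitBody : Prog :=
  -- The test detects an even value. Each of the `n` rounds doubles either `D` or `S`, which keeps
  -- their product under control.
  .seq (.ite (.op .sub (.lit 1) (.op .mod (var 5) (.lit 2)))
      (.seq (assign 6 (.op .mul (.lit 2) (var 6))) (assign 5 (.op .div (var 5) (.lit 2))))
      (assign 7 (.op .mul (.lit 2) (var 7))))
    decr

/-- Split `2 ^ n` as `D * S`, where `D` divides variable `5`. -/
def splitLoop : Prog := .loop (var 8) splitBody

/-- Compute the degree of `g` in variable `12` and prepare the inversion of its leading
coefficient. -/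
def initInverse : Prog :=
  -- The degree of `g` is 1 or 2, and its coefficient at 2 is that of `f` at `2 * S`, a nonnegative
  -- residue; positivity therefore decides the degree.
  .seq (.ite (.get 1 (.op .mul (.lit 2) (var 7))) (assign 12 (.lit 2)) (assign 12 (.lit 1))) <|
    .seq (assign 10 (.get 1 (.op .mul (var 12) (var 7)))) <|
      .seq (assign 9 (.op .sub (.get 0 (.lit 1)) (.lit 2))) (assign 11 (.lit 1))

/-- The body of `inverseLoop`. -/
def inverseBody : Prog :=
  .seq (.ite (.op .mod (var 9) (.lit 2))
      (assign 11 (.op .mod (.op .mul (var 11) (var 10)) (.get 0 (.lit 1)))) .skip) <|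
    .seq (assign 10 (.op .mod (.op .mul (var 10) (var 10)) (.get 0 (.lit 1))))
      (assign 9 (.op .div (var 9) (.lit 2)))

/-- Modular exponentiation by repeated squaring. -/
def inverseLoop : Prog := .loop (var 9) inverseBody

/-- Store an entry of the lattice matrix; its row is in variable `13`, its column in `14`. -/
def fillEntry : Prog :=
  .ite (.op .sub (var 12) (var 13))
    -- `1 - (i - j) ^ 2` is positive exactly when `i = j`.
    (.ite (.op .sub (.lit 1) (.op .mul (.op .sub (var 13) (var 14)) (.op .sub (var 13) (var 14))))
      (.set 3 (var 8) (.get 0 (.lit 1))) (.set 3 (var 8) (.lit 0)))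
    (.ite (.op .sub (.op .add (.op .add (var 14) (var 12)) (.lit 1)) (var 13))
      (.set 3 (var 8) (.op .mod (.op .mul (var 11)
        (.get 1 (.op .mul (.op .sub (.op .add (var 14) (var 12)) (var 13)) (var 7))))
        (.get 0 (.lit 1))))
      (.set 3 (var 8) (.lit 0)))

/-- The body of `fillLoop`. -/
def fillBody : Prog :=
  .seq decr <| .seq (assign 13 (.op .div (var 8) (var 6))) <|
    .seq (assign 14 (.op .mod (var 8) (var 6))) fillEntry

/-- Store the lattice matrix in array `3`. -/
def fillLoop : Prog := .seq (assign 8 (.op .mul (var 6) (var 6))) (.loop (var 8) fillBody)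

/-- The body of `scatterLoop`. -/
def scatterBody : Prog :=
  .seq decr (.ite (.op .mod (var 8) (var 7)) (.set 2 (var 8) (.lit 0))
    (.set 2 (var 8) (.get 4 (.op .div (var 8) (var 7)))))

/-- Write the entries of array `4` to the multiples of `S` in array `2`. -/
def scatterLoop : Prog := .seq (assign 8 (.op .mul (var 6) (var 7))) (.loop (var 8) scatterBody)

/-- Reduction of SVP in a prime ideal to SVP in its contraction to the subfield. -/
def svpReduction : Prog :=
  .seq initSplit <| .seq splitLoop <| .seq initInverse <| .seq inverseLoop <|
    .seq fillLoop <| .seq (.call 3 4) scatterLoop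

end Prog

/-! ### Correctness and cost of the stages of the program. -/

/-- The input `n`, `p` and `φ` is still in memory. -/
structure HasInput (n p : ℕ) (φ : ℕ → ℤ) (L : ℕ) (s : Mem) : Prop where
  bdd : MemBdd L s
  n_eq : s 0 0 = n
  p_eq : s 0 1 = p
  coeff_eq (i : ℕ) : s 1 i = φ i

theorem HasInput.set {n p : ℕ} {φ : ℕ → ℤ} {L : ℕ} {s : Mem} (h : HasInput n p φ L s) {a : ℕ}
    (ha : 2 ≤ a) (i : ℕ) {z : ℤ} (hz : bitLen z ≤ L) : HasInput n p φ L (s.set a i z) := by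
  have h0 : ¬ 0 = a := by omega
  have h1 : ¬ 1 = a := by omega
  exact ⟨h.bdd.set a i hz, by simp [Mem.set, h0, h.n_eq], by simp [Mem.set, h0, h.p_eq],
    fun j => by simp [Mem.set, h1, h.coeff_eq]⟩

section Correctness

open Prog

variable {D₀ : ℕ} {O : Matrix (Fin D₀) (Fin D₀) ℤ → Fin D₀ → ℤ} {K L n p : ℕ} {φ : ℕ → ℤ}

theorem Runs.assign {s : Mem} {a : ℕ} {e : Expr} {Q : Mem → Prop} (z : ℤ)
    (hs : MemBdd L s) (hK : 1 ≤ K) (he : e.len ≤ K)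
    (hz : e.eval s = z) (hQ : Q (s.set a 0 z)) :
    Runs O (stepCost K L) (Prog.assign a e) s Q 1 :=
  Runs.set 0 z hs hK he rfl hz hQ

theorem Runs.assign_seq {s : Mem} {a : ℕ} {e : Expr} {c : Prog} {Q : Mem → Prop} {T : ℕ} (z : ℤ)
    (hs : HasInput n p φ L s) (ha : 2 ≤ a) (hK : 1 ≤ K) (he : e.len ≤ K)
    (hz : e.eval s = z) (hzL : bitLen z ≤ L)
    (h : HasInput n p φ L (s.set a 0 z) → Runs O (stepCost K L) c (s.set a 0 z) Q T) :
    Runs O (stepCost K L) (.seq (Prog.assign a e) c) s Q (T + 2) := by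
  refine (Runs.seq (one_le_stepCost hK) (Runs.assign (Q := fun s' => s' = s.set a 0 z) z hs.bdd hK
    he hz rfl) (fun s' h' => h' ▸ h (hs.set ha 0 hzL))).mono (fun _ h => h) (by omega)

/-- The values of the scalars after `splitLoop`. -/
structure HasSplit (n p : ℕ) (φ : ℕ → ℤ) (L D S : ℕ) (s : Mem) : Prop
    extends HasInput n p φ L s where
  D_eq : s 6 0 = D
  S_eq : s 7 0 = S

theorem HasSplit.set {D S : ℕ} {s : Mem} (h : HasSplit n p φ L D S s) {a : ℕ}
    (ha : 2 ≤ a) (h6 : a ≠ 6) (h7 : a ≠ 7) (i : ℕ) {z : ℤ} (hz : bitLen z ≤ L) :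
    HasSplit n p φ L D S (s.set a i z) :=
  ⟨h.toHasInput.set ha i hz, by simp [Mem.set, h6.symm, h.D_eq], by simp [Mem.set, h7.symm, h.S_eq]⟩

/-- Here and below, 64 bounds the size of every expression of the program, which `decide` verifies.
The conditions on `L` ensure that each stored value has at most `L` bits. -/
theorem runs_initSplit {s : Mem} {q : ℕ} (hs : HasInput n p φ L s) (hL : n < L) (hq : q < 2 ^ L)
    (hq4 : p % 4 = 1 ∧ p = 2 * q + 1 ∨ p % 4 = 3 ∧ q = p + 1) :
    Runs O (stepCost 64 L) initSplit s (fun s' => HasSplit n p φ L 1 1 s' ∧ s' 8 0 = n ∧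
      s' 5 0 = q) 8 := by
  have h1 : bitLen 1 ≤ L := by
    have : 1 < 2 ^ L := Nat.one_lt_two_pow (by omega)
    exact bitLen_natCast_le (m := 1) this
  have hn : bitLen (n : ℤ) ≤ L := hs.n_eq ▸ hs.bdd 0 0
  refine Runs.assign_seq 1 hs (by decide) (by decide) (by decide) rfl h1 fun hs => ?_
  refine Runs.assign_seq 1 hs (by decide) (by decide) (by decide) rfl h1 fun hs => ?_
  refine Runs.assign_seq n hs (by decide) (by decide) (by decide) hs.n_eq hn fun hs => ?_
  have hfin : ∀ {s' : Mem}, s' = ((s.set 6 0 1).set 7 0 1).set 8 0 n →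
      HasSplit n p φ L 1 1 (s'.set 5 0 q) ∧ (s'.set 5 0 q) 8 0 = n ∧ (s'.set 5 0 q) 5 0 = q := by
    rintro s' rfl
    exact ⟨⟨hs.set (by decide) 0 (bitLen_natCast_le hq), by simp [Mem.set], by simp [Mem.set]⟩,
      by simp [Mem.set], by simp [Mem.set]⟩
  have hp := hs.p_eq
  refine Runs.ite hs.bdd (by decide) (fun h => ?_) fun h => ?_
  · refine Runs.assign q hs.bdd (by decide) (by decide) ?_ (hfin rfl)
    simp [Expr.eval, BinOp.eval, hp] at h ⊢
    omega
  · refine Runs.assign q hs.bdd (by decide) (by decide) ?_ (hfin rfl)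
    simp [Expr.eval, BinOp.eval, hp] at h ⊢
    omega

/-- The loop invariant of `splitLoop`, with `k` steps to go. -/
def SplitInv (n p : ℕ) (φ : ℕ → ℤ) (L v m k : ℕ) (s : Mem) : Prop :=
  -- Subtraction is truncated: the factors of 2 go to `D` until the supply of `v` is exhausted, and
  -- every later round goes to `S`.
  k ≤ n ∧ HasSplit n p φ L (2 ^ min v (n - k)) (2 ^ (n - k - v)) s ∧ s 8 0 = k ∧
    s 5 0 = (2 ^ (v - (n - k)) * m : ℕ)

theorem runs_splitBody {s : Mem} {v m k : ℕ} (hm : Odd m) (hL : n < L) (hq : 2 ^ v * m < 2 ^ L)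
    (hs : SplitInv n p φ L v m (k + 1) s) :
    Runs O (stepCost 64 L) splitBody s (SplitInv n p φ L v m k) 6 := by
  obtain ⟨hk, hs, h8, h5⟩ := hs
  have hn : n < 2 ^ L := hL.trans Nat.lt_two_pow_self
  have hpow {j : ℕ} (hj : j ≤ n) : (2 : ℕ) ^ j < 2 ^ L :=
    Nat.pow_lt_pow_right (by omega) (by omega)
  obtain ⟨j, hj⟩ : ∃ j, n - (k + 1) = j := ⟨_, rfl⟩
  rw [hj] at hs h5
  have hj' : n - k = j + 1 := by omega
  have key : Runs O (stepCost 64 L)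
      (.ite (.op .sub (.lit 1) (.op .mod (var 5) (.lit 2)))
      (.seq (Prog.assign 6 (.op .mul (.lit 2) (var 6)))
        (Prog.assign 5 (.op .div (var 5) (.lit 2))))
      (Prog.assign 7 (.op .mul (.lit 2) (var 7)))) s
      (fun s' => HasSplit n p φ L (2 ^ min v (j + 1)) (2 ^ (j + 1 - v)) s' ∧ s' 8 0 = (k + 1 : ℕ) ∧
        s' 5 0 = (2 ^ (v - (j + 1)) * m : ℕ)) 4 := by
    refine Runs.ite hs.bdd (by decide) (fun h => ?_) fun h => ?_
    · simp [Expr.eval, BinOp.eval, var, h5] at h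
      have hvj : j < v := by
        by_contra hle
        rw [show v - j = 0 by omega] at h
        obtain ⟨c, rfl⟩ := hm
        push_cast at h
        omega
      have hD : 2 ^ min v (j + 1) = 2 * 2 ^ min v j := by
        rw [← pow_succ']; congr 1; omega
      have hDL : bitLen ((2 ^ min v (j + 1) : ℕ) : ℤ) ≤ L := bitLen_natCast_le (hpow (by omega))
      have hqe : 2 ^ (v - j) * m = 2 * (2 ^ (v - (j + 1)) * m) := by
        rw [← mul_assoc, ← pow_succ']; congr 2; omega
      have hqL : 2 ^ (v - (j + 1)) * m < 2 ^ L :=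
        lt_of_le_of_lt (Nat.mul_le_mul_right m (Nat.pow_le_pow_right (by omega) (by omega))) hq
      refine Runs.mono (Runs.assign_seq (T := 1) ((2 ^ min v (j + 1) : ℕ) : ℤ) hs.toHasInput
        (by decide) (by decide) (by decide) ?_ hDL fun hs' => ?_) (fun _ h => h) le_rfl
      · rw [hD]
        simp [Expr.eval, BinOp.eval, var, hs.D_eq]
      · refine Runs.assign ((2 ^ (v - (j + 1)) * m : ℕ) : ℤ) hs'.bdd (by decide) (by decide) ?_
          ⟨⟨hs'.set (by decide) 0 (bitLen_natCast_le hqL), ?_, ?_⟩, ?_, ?_⟩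
        · simp only [Expr.eval, BinOp.eval, var, Mem.set, hqe, h5, Int.toNat_zero]
          norm_num
        · simp [Mem.set]
        · have e1 : j - v = 0 := by omega
          have e2 : j + 1 - v = 0 := by omega
          have := hs.S_eq
          rw [e1] at this
          simp [Mem.set, this, e2]
        · simp [Mem.set, h8]
        · simp [Mem.set]
    · simp [Expr.eval, BinOp.eval, var, h5] at h
      have hvj : v ≤ j := by
        by_contra hlt
        obtain ⟨c, hc⟩ : ∃ c, v - j = c + 1 := ⟨v - j - 1, by omega⟩
        rw [hc, pow_succ] at h
        have : (2 : ℤ) ^ c * 2 * m = 2 * (2 ^ c * m) := by ring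
        rw [this] at h
        omega
      have hS : 2 ^ (j + 1 - v) = 2 * 2 ^ (j - v) := by
        rw [← pow_succ']; congr 1; omega
      have hSL : bitLen ((2 ^ (j + 1 - v) : ℕ) : ℤ) ≤ L := bitLen_natCast_le (hpow (by omega))
      refine Runs.mono (Runs.assign (Q := fun s' => HasSplit n p φ L (2 ^ min v (j + 1))
        (2 ^ (j + 1 - v)) s' ∧ s' 8 0 = (k + 1 : ℕ) ∧ s' 5 0 = (2 ^ (v - (j + 1)) * m : ℕ))
        ((2 ^ (j + 1 - v) : ℕ) : ℤ) hs.bdd (by decide) (by decide) ?_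
        ⟨⟨hs.toHasInput.set (by decide) 0 hSL, ?_, ?_⟩, ?_, ?_⟩) (fun _ h => h) (by omega)
      · rw [hS]
        simp [Expr.eval, BinOp.eval, var, hs.S_eq]
      · have := hs.D_eq
        rw [show min v j = v by omega] at this
        rw [show min v (j + 1) = v by omega]
        simpa [Mem.set] using this
      · simp [Mem.set]
      · simp [Mem.set, h8]
      · rw [show v - j = 0 by omega] at h5
        rw [show v - (j + 1) = 0 by omega]
        simpa [Mem.set] using h5
  refine Runs.seq (T' := 1) (one_le_stepCost (by decide)) key ?_
  rintro s' ⟨hs', h8', h5'⟩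
  have hkL : bitLen (k : ℤ) ≤ L := bitLen_natCast_le (by omega)
  refine Runs.assign (k : ℤ) hs'.bdd (by decide) (by decide) ?_ ⟨by omega, ?_, ?_, ?_⟩
  · simp [Expr.eval, BinOp.eval, var, h8']
  · rw [hj']
    exact hs'.set (by decide) (by decide) (by decide) 0 hkL
  · simp [Mem.set]
  · rw [hj', ← h5']
    simp [Mem.set]

theorem runs_splitLoop {s : Mem} {v m : ℕ} (hm : Odd m) (hL : n < L) (hq : 2 ^ v * m < 2 ^ L)
    (hs : HasSplit n p φ L 1 1 s) (h8 : s 8 0 = n) (h5 : s 5 0 = (2 ^ v * m : ℕ)) :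
    Runs O (stepCost 64 L) splitLoop s
      (HasSplit n p φ L (2 ^ min v n) (2 ^ (n - v))) (n * 7 + 1) := by
  refine (Runs.loop (Inv := SplitInv n p φ L v m) (fun k s h => h.2.1.bdd) (by decide)
    (fun s h => ?_) (fun k s h _ => runs_splitBody hm hL hq h) n s ?_).mono ?_ le_rfl
  · simp [var, Expr.eval, h.2.2.1]
  · refine ⟨le_rfl, ?_, h8, ?_⟩
    · simpa using hs
    · simpa using h5
  · rintro s' ⟨k, ⟨-, h, h8', -⟩, hk⟩
    have : k = 0 := by simpa [var, Expr.eval, h8'] using hk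
    subst this
    simpa using h

/-- The values of the scalars once the degree `d` is known. -/
structure HasDegree (n p : ℕ) (φ : ℕ → ℤ) (L D S d : ℕ) (s : Mem) : Prop
    extends HasSplit n p φ L D S s where
  d_eq : s 12 0 = d

theorem HasDegree.set {D S d : ℕ} {s : Mem} (h : HasDegree n p φ L D S d s) {a : ℕ}
    (ha : 2 ≤ a) (h6 : a ≠ 6) (h7 : a ≠ 7) (h12 : a ≠ 12) (i : ℕ) {z : ℤ} (hz : bitLen z ≤ L) :
    HasDegree n p φ L D S d (s.set a i z) :=
  ⟨h.toHasSplit.set ha h6 h7 i hz, by simp [Mem.set, h12.symm, h.d_eq]⟩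

theorem runs_initInverse {s : Mem} {D S d : ℕ} (hs : HasSplit n p φ L D S s) (hL : 1 < L)
    (hp : 2 ≤ p) (hd : 0 < φ (2 * S) ∧ d = 2 ∨ ¬ 0 < φ (2 * S) ∧ d = 1) :
    Runs O (stepCost 64 L) initInverse s (fun s' => HasDegree n p φ L D S d s' ∧
      s' 9 0 = (p - 2 : ℕ) ∧ s' 10 0 = φ (d * S) ∧ s' 11 0 = 1) 8 := by
  have hpL : bitLen (p : ℤ) ≤ L := hs.p_eq ▸ hs.bdd 0 1
  have hdL : bitLen (d : ℤ) ≤ L := bitLen_natCast_le (by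
    have : 2 ^ 2 ≤ 2 ^ L := Nat.pow_le_pow_right (by omega) (by omega)
    omega)
  have key : Runs O (stepCost 64 L) (.ite (.get 1 (.op .mul (.lit 2) (var 7)))
      (Prog.assign 12 (.lit 2)) (Prog.assign 12 (.lit 1))) s
      (HasDegree n p φ L D S d) 2 := by
    have hfin : HasDegree n p φ L D S d (s.set 12 0 d) :=
      ⟨hs.set (by decide) (by decide) (by decide) 0 hdL, by simp [Mem.set]⟩
    have he : Expr.eval s (.get 1 (.op .mul (.lit 2) (var 7))) = φ (2 * S) := by
      simp only [Expr.eval, BinOp.eval, var, Int.toNat_zero, hs.S_eq, hs.coeff_eq]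
      rfl
    refine Runs.ite hs.bdd (by decide) (fun h => ?_) fun h => ?_
    · rw [he] at h
      obtain ⟨-, rfl⟩ | ⟨h', -⟩ := hd
      · exact Runs.assign _ hs.bdd (by decide) (by decide) rfl hfin
      · exact absurd h h'
    · rw [he] at h
      obtain ⟨h', -⟩ | ⟨-, rfl⟩ := hd
      · exact absurd h' h
      · exact Runs.assign _ hs.bdd (by decide) (by decide) rfl hfin
  refine (Runs.seq (T' := 5) (one_le_stepCost (by decide)) key fun s' h => ?_).mono
    (fun _ h => h) le_rfl
  refine Runs.assign_seq (φ (d * S)) h.toHasInput (by decide) (by decide) (by decide) ?_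
    (h.coeff_eq (d * S) ▸ h.bdd _ _) fun h1 => ?_
  · simp only [Expr.eval, BinOp.eval, var, Int.toNat_zero, h.S_eq, h.d_eq, h.coeff_eq]
    rfl
  have hp2 : bitLen ((p - 2 : ℕ) : ℤ) ≤ L := (bitLen_mono (by simp)).trans hpL
  refine Runs.assign_seq ((p - 2 : ℕ) : ℤ) h1 (by decide) (by decide) (by decide) ?_
    hp2 fun h2 => ?_
  · simp only [Expr.eval, BinOp.eval]
    have := h1.p_eq
    simp only [Int.toNat_one, this]
    push_cast [hp]
    rfl
  · have h10 : bitLen (φ (d * S)) ≤ L := h.coeff_eq (d * S) ▸ h.bdd _ _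
    refine Runs.assign 1 h2.bdd (by decide) (by decide) rfl ⟨?_, ?_, ?_, ?_⟩
    · exact ((h.set (by decide) (by decide) (by decide) (by decide) 0 h10).set (by decide)
        (by decide) (by decide) (by decide) 0 hp2).set (by decide) (by decide) (by decide)
        (by decide) 0 (bitLen_natCast_le (m := 1) (Nat.one_lt_two_pow (by omega)))
    · simp [Mem.set]
    · simp [Mem.set]
    · simp [Mem.set]

/-- The loop invariant of `inverseLoop`: `w` is the power to be computed. -/
def InverseInv (n p : ℕ) (φ : ℕ → ℤ) (L D S d : ℕ) (w : ZMod p) (k : ℕ) (s : Mem) : Prop :=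
  HasDegree n p φ L D S d s ∧ ∃ e b c : ℕ, s 9 0 = e ∧ e < 2 ^ k ∧ s 10 0 = b ∧ b < p ∧
    s 11 0 = c ∧ c < p ∧ (c : ZMod p) * b ^ e = w

theorem runs_inverseBody {s : Mem} {D S d k : ℕ} {w : ZMod p} (hpL : p < 2 ^ L)
    (hs : InverseInv n p φ L D S d w (k + 1) s) :
    Runs O (stepCost 64 L) inverseBody s (InverseInv n p φ L D S d w k) 6 := by
  obtain ⟨hs, e, b, c, h9, he, h10, hb, h11, hc, hw⟩ := hs
  have hp0 : 0 < p := by omega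
  have key : Runs O (stepCost 64 L) (.ite (.op .mod (var 9) (.lit 2))
      (Prog.assign 11 (.op .mod (.op .mul (var 11) (var 10)) (.get 0 (.lit 1)))) .skip) s
      (fun s' => HasDegree n p φ L D S d s' ∧ s' 9 0 = e ∧ s' 10 0 = b ∧
        ∃ c : ℕ, s' 11 0 = c ∧ c < p ∧ (c : ZMod p) * (b * b) ^ (e / 2) = w) 2 := by
    refine Runs.ite hs.bdd (by decide) (fun h => ?_) fun h => ?_
    · have h : e % 2 = 1 := by
        simp [Expr.eval, BinOp.eval, var, h9] at h
        omega
      have hlt : c * b % p < p := Nat.mod_lt _ hp0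
      refine Runs.assign ((c * b % p : ℕ) : ℤ) hs.bdd (by decide) (by decide) ?_
        ⟨?_, ?_, ?_, c * b % p, ?_, hlt, ?_⟩
      · simp [Expr.eval, BinOp.eval, var, h10, h11, hs.p_eq]
      · exact hs.set (by decide) (by decide) (by decide) (by decide) 0
          (bitLen_natCast_le (hlt.trans hpL))
      · simp [Mem.set, h9]
      · simp [Mem.set, h10]
      · simp [Mem.set]
      · have he2 : e = 2 * (e / 2) + 1 := by omega
        rw [← hw, ZMod.natCast_mod, ← pow_two, ← pow_mul]
        conv_rhs => rw [he2]
        push_cast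
        ring
    · have h : e % 2 = 0 := by
        simp [Expr.eval, BinOp.eval, var, h9] at h
        omega
      refine Runs.skip (one_le_stepCost (by decide)) ⟨hs, h9, h10, c, h11, hc, ?_⟩
      rw [← hw, ← pow_two, ← pow_mul]
      congr 2
      omega
  refine (Runs.seq (T' := 3) (one_le_stepCost (by decide)) key ?_)
  rintro s' ⟨hs, h9, h10, c, h11, hc, hw⟩
  have hlt : b * b % p < p := Nat.mod_lt _ hp0
  have hbL : bitLen ((b * b % p : ℕ) : ℤ) ≤ L := bitLen_natCast_le (hlt.trans hpL)
  have heL : bitLen ((e / 2 : ℕ) : ℤ) ≤ L := by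
    refine (bitLen_mono (z := (e : ℤ)) ?_).trans (h9 ▸ hs.bdd 9 0)
    have := Nat.div_le_self e 2
    omega
  refine Runs.assign_seq ((b * b % p : ℕ) : ℤ) hs.toHasInput (by decide) (by decide) (by decide)
    ?_ hbL fun h1 => ?_
  · simp [Expr.eval, BinOp.eval, var, h10, hs.p_eq]
  refine Runs.assign ((e / 2 : ℕ) : ℤ) h1.bdd (by decide) (by decide) ?_
    ⟨?_, e / 2, b * b % p, c, ?_, ?_, ?_, hlt, ?_, hc, ?_⟩
  · simp [Expr.eval, BinOp.eval, var, h9, Mem.set]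
  · exact (hs.set (by decide) (by decide) (by decide) (by decide) 0 hbL).set (by decide)
      (by decide) (by decide) (by decide) 0 heL
  · simp [Mem.set]
  · rw [pow_succ] at he
    omega
  · simp [Mem.set]
  · simp [Mem.set, h11]
  · rw [ZMod.natCast_mod, Nat.cast_mul, hw]

/-- The values of the scalars once the inverse `c` of the leading coefficient is known. -/
structure HasInverse (n p : ℕ) (φ : ℕ → ℤ) (L D S d c : ℕ) (s : Mem) : Prop
    extends HasDegree n p φ L D S d s where
  c_eq : s 11 0 = c

theorem HasInverse.set {D S d c : ℕ} {s : Mem} (h : HasInverse n p φ L D S d c s) {a : ℕ}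
    (ha : 2 ≤ a) (h6 : a ≠ 6) (h7 : a ≠ 7) (h11 : a ≠ 11) (h12 : a ≠ 12) (i : ℕ) {z : ℤ}
    (hz : bitLen z ≤ L) : HasInverse n p φ L D S d c (s.set a i z) :=
  ⟨h.toHasDegree.set ha h6 h7 h12 i hz, by simp [Mem.set, h11.symm, h.c_eq]⟩

theorem runs_inverseLoop {s : Mem} {D S d b : ℕ} (hp : p.Prime) (hpL : p < 2 ^ L)
    (hs : HasDegree n p φ L D S d s) (h9 : s 9 0 = (p - 2 : ℕ)) (h10 : s 10 0 = b)
    (hb : b < p) (hb0 : (b : ZMod p) ≠ 0) (h11 : s 11 0 = 1) :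
    Runs O (stepCost 64 L) inverseLoop s
      (fun s' => ∃ c : ℕ, (c : ZMod p) * b = 1 ∧ HasInverse n p φ L D S d c s') (L * 7 + 1) := by
  have := Fact.mk hp
  have hp2 := hp.two_le
  -- The exponent `p - 2 < 2 ^ L` is halved in each round, so `L` rounds suffice.
  refine (Runs.loop (Inv := InverseInv n p φ L D S d ((b : ZMod p) ^ (p - 2)))
    (fun k s h => h.1.bdd) (by decide) ?_ (fun k s h _ => runs_inverseBody hpL h) L s ?_).mono
    ?_ le_rfl
  · rintro s ⟨-, e, -, -, h9, he, -⟩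
    have : e = 0 := by omega
    simp [Expr.eval, var, h9, this]
  · exact ⟨hs, p - 2, b, 1, h9, by omega, h10, hb, by simpa using h11, by omega, by simp⟩
  · rintro s' ⟨k, ⟨hs, e, b', c, h9, -, -, -, h11, hc, hw⟩, he⟩
    have he : e = 0 := by simpa [Expr.eval, var, h9] using he
    refine ⟨c, ?_, hs, h11⟩
    rw [he, pow_zero, mul_one] at hw
    -- Fermat: `b ^ (p - 2) * b = b ^ (p - 1) = 1`.
    rw [hw, ← pow_succ, show p - 2 + 1 = p - 1 by omega, ZMod.pow_card_sub_one_eq_one hb0]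

/-- The entries of the matrix stored by `fillLoop`. -/
def matrixEntry (p : ℕ) (φ : ℕ → ℤ) (S d c i j : ℕ) : ℤ :=
  if i < d then if i = j then (p : ℤ) else 0
  -- The coefficient of `X ^ (i - d) * G` at `j` is that of `G` at `j + d - i`, and `G` is `c * g`
  -- with coefficients reduced modulo `p`.
  else if i ≤ j + d then (c * φ ((j + d - i) * S)) % p else 0

/-- The loop invariant of `fillLoop`, with `k` entries to go. -/
def FillInv (n p : ℕ) (φ : ℕ → ℤ) (L D S d c k : ℕ) (s : Mem) : Prop :=
  HasInverse n p φ L D S d c s ∧ s 8 0 = k ∧ k ≤ D * D ∧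
    ∀ i, k ≤ i → i < D * D → s 3 i = matrixEntry p φ S d c (i / D) (i % D)

theorem bitLen_emod_le {z : ℤ} (hp : 0 < p) (hpL : p < 2 ^ L) : bitLen (z % p) ≤ L := by
  have h1 := Int.emod_nonneg z (b := p) (by omega)
  have h2 := Int.emod_lt_of_pos z (b := p) (by omega)
  rw [bitLen_le_iff]
  omega

theorem runs_fillEntry {s : Mem} {D S d c i j k : ℕ} (hp : 0 < p) (hpL : p < 2 ^ L)
    (hs : HasInverse n p φ L D S d c s) (h8 : s 8 0 = k) (h13 : s 13 0 = i) (h14 : s 14 0 = j)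
    {Q : Mem → Prop} (hQ : bitLen (matrixEntry p φ S d c i j) ≤ L →
      Q (s.set 3 k (matrixEntry p φ S d c i j))) :
    Runs O (stepCost 64 L) fillEntry s Q 3 := by
  have h8' : (Expr.eval s (var 8)).toNat = k := by simp [Expr.eval, var, h8]
  have hp' : Expr.eval s (.get 0 (.lit 1)) = p := hs.p_eq
  refine Runs.ite hs.bdd (by decide) (fun h => ?_) fun h => ?_
  · simp [Expr.eval, BinOp.eval, var, hs.d_eq, h13] at h
    refine Runs.ite hs.bdd (by decide) (fun h' => ?_) fun h' => ?_
    · simp only [Expr.eval, BinOp.eval, var, h13, h14, Int.toNat_zero] at h'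
      have hij : i = j := by
        have : ((i : ℤ) - j) * (i - j) < 1 := by linarith
        have h0 : ((i : ℤ) - j) * (i - j) = 0 := le_antisymm (by omega) (mul_self_nonneg _)
        have := mul_self_eq_zero.1 h0
        omega
      have he : matrixEntry p φ S d c i j = p := by simp [matrixEntry, h, hij.symm]
      rw [he] at hQ
      exact Runs.set k p hs.bdd (by decide) (by decide) h8' hp' (hQ (bitLen_natCast_le hpL))
    · simp only [Expr.eval, BinOp.eval, var, h13, h14, Int.toNat_zero] at h'
      have hij : i ≠ j := by
        rintro rfl
        simp at h'
      have he : matrixEntry p φ S d c i j = 0 := by simp [matrixEntry, h, hij]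
      rw [he] at hQ
      exact Runs.set k 0 hs.bdd (by decide) (by decide) h8' rfl (hQ (bitLen_le_iff.2 (by simp)))
  · simp [Expr.eval, BinOp.eval, var, hs.d_eq, h13] at h
    refine (Runs.ite (T := 1) hs.bdd (by decide) (fun h' => ?_) fun h' => ?_).mono (fun _ h => h)
      (by omega)
    · have hij : i ≤ j + d := by
        simp [Expr.eval, BinOp.eval, var, hs.d_eq, h13, h14] at h'
        omega
      have he : matrixEntry p φ S d c i j = (c * φ ((j + d - i) * S)) % p := by
        simp [matrixEntry, not_lt.2 h, hij]
      rw [he] at hQ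
      refine Runs.set k ((c * φ ((j + d - i) * S)) % p) hs.bdd (by decide) (by decide) h8' ?_
        (hQ (bitLen_emod_le hp hpL))
      have hi : (((j : ℤ) + d - i) * S).toNat = (j + d - i) * S := by
        rw [← Nat.cast_add, ← Nat.cast_sub hij, ← Nat.cast_mul, Int.toNat_natCast]
      simp [Expr.eval, BinOp.eval, var, h13, h14, hs.d_eq, hs.S_eq, hs.c_eq, hs.p_eq, hi,
        hs.coeff_eq]
    · have hij : ¬ i ≤ j + d := by
        simp [Expr.eval, BinOp.eval, var, hs.d_eq, h13, h14] at h'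
        omega
      have he : matrixEntry p φ S d c i j = 0 := by simp [matrixEntry, not_lt.2 h, hij]
      rw [he] at hQ
      exact Runs.set k 0 hs.bdd (by decide) (by decide) h8' rfl (hQ (bitLen_le_iff.2 (by simp)))

theorem runs_fillBody {s : Mem} {D S d c k : ℕ} (hp : 0 < p) (hpL : p < 2 ^ L)
    (hDL : D * D < 2 ^ L) (hs : FillInv n p φ L D S d c (k + 1) s) :
    Runs O (stepCost 64 L) fillBody s (FillInv n p φ L D S d c k) 9 := by
  obtain ⟨hs, h8, hk, h3⟩ := hs
  have hk' : bitLen (k : ℤ) ≤ L := bitLen_natCast_le (by omega)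
  have hi : bitLen ((k / D : ℕ) : ℤ) ≤ L :=
    bitLen_natCast_le (lt_of_le_of_lt (Nat.div_le_self _ _) (by omega))
  have hj : bitLen ((k % D : ℕ) : ℤ) ≤ L :=
    bitLen_natCast_le (lt_of_le_of_lt (Nat.mod_le _ _) (by omega))
  refine Runs.assign_seq (T := 7) (k : ℤ) hs.toHasInput (by decide) (by decide) (by decide) ?_ hk'
    fun h1 => ?_
  · simp [Expr.eval, BinOp.eval, var, h8]
  refine Runs.assign_seq (T := 5) ((k / D : ℕ) : ℤ) h1 (by decide) (by decide) (by decide) ?_ hi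
    fun h2 => ?_
  · simp [Expr.eval, BinOp.eval, var, Mem.set, hs.D_eq]
  refine Runs.assign_seq (T := 3) ((k % D : ℕ) : ℤ) h2 (by decide) (by decide) (by decide) ?_ hj
    fun _ => ?_
  · simp [Expr.eval, BinOp.eval, var, Mem.set, hs.D_eq]
  have hs' := ((hs.set (a := 8) (by decide) (by decide) (by decide) (by decide) (by decide) 0
    hk').set (a := 13) (by decide) (by decide) (by decide) (by decide) (by decide) 0 hi).set
    (a := 14) (by decide) (by decide) (by decide) (by decide) (by decide) 0 hj
  refine runs_fillEntry (k := k) (i := k / D) (j := k % D) hp hpL hs' (by simp [Mem.set])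
    (by simp [Mem.set]) (by simp [Mem.set]) fun hz => ⟨?_, ?_, by omega, ?_⟩
  · exact hs'.set (by decide) (by decide) (by decide) (by decide) (by decide) k hz
  · simp [Mem.set]
  · intro i hki hiD
    rcases eq_or_lt_of_le hki with rfl | hlt
    · simp [Mem.set]
    · have : i ≠ k := by omega
      simpa [Mem.set, this] using h3 i hlt hiD

theorem runs_fillLoop {s : Mem} {D S d c : ℕ} (hp : 0 < p) (hpL : p < 2 ^ L)
    (hDL : D * D < 2 ^ L) (hs : HasInverse n p φ L D S d c s) :
    Runs O (stepCost 64 L) fillLoop s (fun s' => HasInverse n p φ L D S d c s' ∧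
      ∀ i < D * D, s' 3 i = matrixEntry p φ S d c (i / D) (i % D)) (D * D * 10 + 1 + 2) := by
  have hDD : bitLen ((D * D : ℕ) : ℤ) ≤ L := bitLen_natCast_le hDL
  refine Runs.assign_seq ((D * D : ℕ) : ℤ) hs.toHasInput (by decide) (by decide) (by decide) ?_
    hDD fun h1 => ?_
  · simp [Expr.eval, BinOp.eval, var, hs.D_eq]
  refine (Runs.loop (Inv := FillInv n p φ L D S d c)
    (fun k s h => h.1.bdd) (by decide) ?_ (fun k s h _ => runs_fillBody hp hpL hDL h) (D * D) _
    ?_).mono ?_ le_rfl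
  · intro s h
    simp [Expr.eval, var, h.2.1]
  · refine ⟨hs.set (by decide) (by decide) (by decide) (by decide) (by decide) 0 hDD, ?_, le_rfl,
      fun i h1 h2 => absurd h1 (by omega)⟩
    simp [Mem.set]
  · rintro s' ⟨k, ⟨hs, h8, -, h3⟩, hk⟩
    have : k = 0 := by simpa [Expr.eval, var, h8] using hk
    subst this
    exact ⟨hs, fun i hi => h3 i (by omega) hi⟩

/-- The loop invariant of `scatterLoop`, with `k` entries to go. -/
def ScatterInv (n p : ℕ) (φ : ℕ → ℤ) (L D S : ℕ) (x : ℕ → ℤ) (k : ℕ) (s : Mem) : Prop :=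
  HasSplit n p φ L D S s ∧ s 8 0 = k ∧ k ≤ D * S ∧ (∀ i, s 4 i = x i) ∧
    ∀ i, k ≤ i → i < D * S → s 2 i = if S ∣ i then x (i / S) else 0

theorem runs_scatterBody {s : Mem} {D S k : ℕ} {x : ℕ → ℤ} (hDL : D * S < 2 ^ L)
    (hs : ScatterInv n p φ L D S x (k + 1) s) :
    Runs O (stepCost 64 L) scatterBody s (ScatterInv n p φ L D S x k) 4 := by
  obtain ⟨hs, h8, hk, h4, h2⟩ := hs
  have hk' : bitLen (k : ℤ) ≤ L := bitLen_natCast_le (by omega)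
  refine Runs.assign_seq (T := 2) (k : ℤ) hs.toHasInput (by decide) (by decide) (by decide) ?_ hk'
    fun h1 => ?_
  · simp [Expr.eval, BinOp.eval, var, h8]
  have hs' := hs.set (a := 8) (by decide) (by decide) (by decide) 0 hk'
  have hfin {z : ℤ} (hz : bitLen z ≤ L) (he : z = if S ∣ k then x (k / S) else 0) :
      ScatterInv n p φ L D S x k ((s.set 8 0 k).set 2 k z) := by
    refine ⟨hs'.set (by decide) (by decide) (by decide) k hz, ?_, by omega, ?_, ?_⟩
    · simp [Mem.set]
    · simpa [Mem.set] using h4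
    · intro i hki hiD
      rcases eq_or_lt_of_le hki with rfl | hlt
      · simp [Mem.set, he]
      · have : i ≠ k := by omega
        simpa [Mem.set, this] using h2 i hlt hiD
  refine Runs.ite h1.bdd (by decide) (fun h => ?_) fun h => ?_
  · have h : ¬ S ∣ k := by
      simp [Expr.eval, BinOp.eval, var, Mem.set, hs.S_eq] at h
      rw [Nat.dvd_iff_mod_eq_zero]
      omega
    exact Runs.set k 0 h1.bdd (by decide) (by decide) (by simp [Expr.eval, var, Mem.set]) rfl
      (hfin (bitLen_le_iff.2 (by simp)) (by simp [h]))
  · have h : S ∣ k := by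
      simp [Expr.eval, BinOp.eval, var, Mem.set, hs.S_eq] at h
      rw [Nat.dvd_iff_mod_eq_zero]
      omega
    refine Runs.set k (x (k / S)) h1.bdd (by decide) (by decide)
      (by simp [Expr.eval, var, Mem.set]) ?_ (hfin (h4 (k / S) ▸ hs.bdd _ _) (by simp [h]))
    rw [← h4]
    simp only [Expr.eval, BinOp.eval, var, Mem.set, Int.toNat_zero, hs.S_eq]
    norm_num
    rfl

theorem runs_scatterLoop {s : Mem} {D S : ℕ} (hDL : D * S < 2 ^ L)
    (hs : HasSplit n p φ L D S s) :
    Runs O (stepCost 64 L) scatterLoop s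
      (fun s' => ∀ i < D * S, s' 2 i = if S ∣ i then s 4 (i / S) else 0)
      (D * S * 5 + 1 + 2) := by
  have hDS : bitLen ((D * S : ℕ) : ℤ) ≤ L := bitLen_natCast_le hDL
  refine Runs.assign_seq ((D * S : ℕ) : ℤ) hs.toHasInput (by decide) (by decide) (by decide) ?_
    hDS fun h1 => ?_
  · simp [Expr.eval, BinOp.eval, var, hs.D_eq, hs.S_eq]
  refine (Runs.loop (Inv := ScatterInv n p φ L D S (s 4))
    (fun k s h => h.1.bdd) (by decide) ?_ (fun k s h _ => runs_scatterBody hDL h) (D * S) _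
    ?_).mono ?_ le_rfl
  · intro s h
    simp [Expr.eval, var, h.2.1]
  · refine ⟨hs.set (by decide) (by decide) (by decide) 0 hDS, ?_, le_rfl, ?_,
      fun i h1 h2 => absurd h1 (by omega)⟩
    · simp [Mem.set]
    · simp [Mem.set]
  · rintro s' ⟨k, ⟨hs, h8, -, -, h2⟩, hk⟩
    have : k = 0 := by simpa [Expr.eval, var, h8] using hk
    subst this
    exact fun i hi => h2 i (by omega) hi

theorem HasSplit.setVec {D S : ℕ} {s : Mem} (h : HasSplit n p φ L D S s) {v : Fin D₀ → ℤ}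
    (hv : ∀ j, bitLen (v j) ≤ L) : HasSplit n p φ L D S (s.setVec 4 v) where
  bdd := h.bdd.setVec 4 hv
  n_eq := by simp [Mem.setVec, h.n_eq]
  p_eq := by simp [Mem.setVec, h.p_eq]
  coeff_eq i := by simp [Mem.setVec, h.coeff_eq]
  D_eq := by simp [Mem.setVec, h.D_eq]
  S_eq := by simp [Mem.setVec, h.S_eq]

end Correctness

/-- The inverse `c` is known only through the run, so `hO` bounds the answer for every possible
inverse and the postcondition returns the one that was used. -/
theorem runs_svpReduction {n p L D S v m q d b : ℕ} {φ : ℕ → ℤ} {s : Mem}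
    (O : Matrix (Fin D) (Fin D) ℤ → Fin D → ℤ) (hs : HasInput n p φ L s) (hp : p.Prime)
    (hL : n < L) (hpL : p < 2 ^ L) (hDL : D * D < 2 ^ L) (hDSL : D * S < 2 ^ L)
    (hqL : q < 2 ^ L) (hq4 : p % 4 = 1 ∧ p = 2 * q + 1 ∨ p % 4 = 3 ∧ q = p + 1) (hm : Odd m)
    (hq : q = 2 ^ v * m) (hD : D = 2 ^ min v n) (hS : S = 2 ^ (n - v)) (hL1 : 1 < L)
    (hd : 0 < φ (2 * S) ∧ d = 2 ∨ ¬ 0 < φ (2 * S) ∧ d = 1) (hb : φ (d * S) = b) (hbp : b < p)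
    (hb0 : (b : ZMod p) ≠ 0)
    (hO : ∀ c : ℕ, (c : ZMod p) * b = 1 →
      ∀ j, bitLen (O (fun i j => matrixEntry p φ S d c i j) j) ≤ L) :
    Runs O (stepCost 64 L) Prog.svpReduction s
      (fun s' => ∃ c : ℕ, (c : ZMod p) * b = 1 ∧ ∀ i, i < D * S → ∀ h : i / S < D,
        s' 2 i = if S ∣ i then O (fun i j => matrixEntry p φ S d c i j) ⟨i / S, h⟩ else 0)
      (7 * n + 7 * L + 11 * (D * D) + D + 5 * (D * S) + 31) := by
  have hU : 1 ≤ stepCost 64 L := one_le_stepCost (by decide)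
  refine Runs.mono (T := 8 + ((n * 7 + 1) + (8 + ((L * 7 + 1) + ((D * D * 10 + 1 + 2) +
    ((1 + D * D + D) + (D * S * 5 + 1 + 2) + 1) + 1) + 1) + 1) + 1) + 1) ?_ (fun _ h => h)
    (by nlinarith)
  refine Runs.seq hU (runs_initSplit hs hL hqL hq4) ?_
  rintro s₁ ⟨h₁, h8, h5⟩
  refine Runs.seq hU (runs_splitLoop hm hL (hq ▸ hqL) h₁ h8 (hq ▸ h5)) ?_
  rw [← hD, ← hS]
  intro s₂ h₂
  refine Runs.seq hU (runs_initInverse h₂ hL1 hp.two_le hd) ?_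
  rintro s₃ ⟨h₃, h9, h10, h11⟩
  refine Runs.seq hU (runs_inverseLoop hp hpL h₃ h9 (h10.trans hb) hbp hb0 h11) ?_
  rintro s₄ ⟨c, hc, h₄⟩
  refine Runs.seq hU (runs_fillLoop hp.pos hpL hDL h₄) ?_
  rintro s₅ ⟨h₅, hfill⟩
  have hM : s₅.matrix D 3 = fun i j : Fin D => matrixEntry p φ S d c i j := by
    ext i j
    have hlt : (i : ℕ) * D + j < D * D := by
      have : ((i : ℕ) + 1) * D ≤ D * D := Nat.mul_le_mul_right D i.2
      have := j.2
      rw [add_mul] at *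
      omega
    have hD0 : 0 < D := i.pos
    rw [Mem.matrix, hfill _ hlt, mul_comm (i : ℕ) D, Nat.mul_add_div hD0, Nat.mul_add_mod,
      Nat.div_eq_of_lt j.2, Nat.mod_eq_of_lt j.2, add_zero]
  have hOL : ∀ j, bitLen (O (s₅.matrix D 3) j) ≤ L := by
    rw [hM]
    exact hO c hc
  refine Runs.seq (R := fun s' => s' = s₅.setVec 4 (O (s₅.matrix D 3))) hU
    (Runs.call (by decide) h₅.bdd hOL rfl) ?_
  rintro s₆ rfl
  refine (runs_scatterLoop hDSL (h₅.toHasSplit.setVec hOL)).mono ?_ le_rfl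
  intro s₇ h₇
  refine ⟨c, hc, fun i hi h => ?_⟩
  rw [h₇ i hi]
  simp only [Mem.setVec, h, true_and, dif_pos, hM]

/-! ### The stored matrix as a lattice basis, and the final assembly. -/

/-- Reducing to residues in `{0, …, p - 1}` makes the leading coefficient exactly 1 and the
coefficients above `d` exactly 0 over `ℤ`, not just modulo `p`. -/
theorem exists_monic_lift {p d S c : ℕ} {φ : ℕ → ℤ} {g : (ZMod p)[X]} (hp : 1 < p)
    (hgd : g.natDegree = d) (hφ : ∀ k, (φ (k * S) : ZMod p) = g.coeff k)
    (hc : (c : ZMod p) * g.leadingCoeff = 1) :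
    ∃ G : ℤ[X], G.Monic ∧ G.natDegree = d ∧ G.map (Int.castRingHom (ZMod p)) = C (c : ZMod p) * g ∧
      ∀ k, G.coeff k = (c * φ (k * S)) % p := by
  have hcast (k : ℕ) : (((c * φ (k * S)) % p : ℤ) : ZMod p) = c * g.coeff k := by
    rw [ZMod.intCast_mod]
    push_cast
    rw [hφ]
  have hz {k : ℕ} (hk : d < k) : (c * φ (k * S)) % p = 0 := by
    have := hcast k
    rw [coeff_eq_zero_of_natDegree_lt (hgd ▸ hk), mul_zero, ZMod.intCast_zmod_eq_zero_iff_dvd] at this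
    have := Int.emod_eq_zero_of_dvd this
    rwa [Int.emod_emod_of_dvd _ dvd_rfl] at this
  have hone : (c * φ (d * S)) % p = 1 := by
    have := hcast d
    rw [← hgd, coeff_natDegree, hc, hgd, ZMod.intCast_mod, ← Int.cast_one,
      ZMod.intCast_eq_intCast_iff] at this
    have h1 : (1 : ℤ) % p = 1 := Int.emod_eq_of_lt (by omega) (by omega)
    exact Eq.trans this h1
  let G : ℤ[X] := ∑ k ∈ Finset.range (d + 1), C ((c * φ (k * S)) % p) * X ^ k
  have hG (k : ℕ) : G.coeff k = (c * φ (k * S)) % p := by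
    simp only [G, finsetSum_coeff, coeff_C_mul_X_pow, Finset.sum_ite_eq, Finset.mem_range]
    split_ifs with hk
    · rfl
    · exact (hz (by omega)).symm
  have hdeg : G.natDegree ≤ d := by
    rw [natDegree_le_iff_coeff_eq_zero]
    intro k hk
    rw [hG, hz hk]
  refine ⟨G, monic_of_natDegree_le_of_coeff_eq_one d hdeg (by rw [hG, hone]), ?_, ?_, hG⟩
  · exact natDegree_eq_of_le_of_coeff_ne_zero hdeg (by rw [hG, hone]; exact one_ne_zero)
  · ext k
    rw [coeff_map, hG, coeff_C_mul, eq_intCast, hcast]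

theorem latticeMatrix_eq_matrixEntry {p d S c D : ℕ} {φ : ℕ → ℤ} {G : ℤ[X]}
    (hG : ∀ k, G.coeff k = (c * φ (k * S)) % p) :
    latticeMatrix p d G D = fun i j : Fin D => matrixEntry p φ S d c i j := by
  ext i j
  simp only [latticeMatrix, latticeRow, matrixEntry]
  by_cases h : (i : ℕ) < d
  · rw [if_pos h, if_pos h, coeff_C_mul_X_pow]
    simp only [eq_comm]
  · rw [if_neg h, if_neg h, coeff_X_pow_mul', hG]
    by_cases h' : (i : ℕ) ≤ j + d
    · rw [if_pos h', if_pos (by omega), show (j : ℕ) - (i - d) = j + d - i by omega]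
    · rw [if_neg h', if_neg (by omega)]

theorem polyLattice_C_mul {p N : ℕ} {c : ZMod p} (hc : IsUnit c) (g : (ZMod p)[X]) :
    polyLattice p N (C c * g) = polyLattice p N g := by
  ext h
  rw [mem_polyLattice, mem_polyLattice, (hc.map C).mul_left_dvd]

theorem C_mem_polyLattice {p D : ℕ} (g : (ZMod p)[X]) (hD : 0 < D) :
    C (p : ℤ) ∈ polyLattice p D g := by
  refine ⟨degree_C_le.trans_lt (by exact_mod_cast hD), ?_⟩
  simp

theorem norm_coefVec_C {D : ℕ} (hD : 0 < D) (p : ℕ) : ‖coefVec D (C (p : ℤ))‖ = p := by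
  rw [← sq_eq_sq₀ (norm_nonneg _) (Nat.cast_nonneg p), norm_sq_coefVec, Finset.sum_eq_single 0]
  · simp
  · intro i _ hi
    simp [hi]
  · intro h
    exact absurd (Finset.mem_range.2 hD) h

/-- The constant polynomial `p` gives a lattice vector of norm `p`. This is what bounds the cost of
the oracle's answer independently of the oracle. -/
theorem natAbs_le_of_isShortestVector {p D : ℕ} (hp : p ≠ 0) {g : (ZMod p)[X]} {x : Fin D → ℤ}
    (hx : IsShortestVector ((polyLattice p D g).map (coefVec D)) (intVec x)) (j : Fin D) :
    (x j).natAbs ≤ p := by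
  have hD : 0 < D := j.pos
  have hC := C_mem_polyLattice g hD
  have h1 := hx.2.2 _ ⟨_, hC, rfl⟩
    (coefVec_ne_zero hC.1 (by rw [Ne, C_eq_zero]; exact_mod_cast hp))
  rw [norm_coefVec_C hD] at h1
  have h2 : ‖(intVec x) j‖ ≤ ‖intVec x‖ := PiLp.norm_apply_le _ _
  have h3 : |(x j : ℝ)| ≤ p := h2.trans h1
  rw [← Int.cast_abs, Int.abs_eq_natAbs] at h3
  exact_mod_cast h3

/-- The number of steps is quadratic in `2 ^ n + l`, because the matrix has `D * D` entries with `D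
≤ 2 ^ n`, and the cost per step is quadratic as well; hence the exponent 4. -/
theorem cost_bound {n l D S : ℕ} (hDS : D * S = 2 ^ n) (hS : 0 < S) :
    (7 * n + 7 * (2 * n + l + 3) + 11 * (D * D) + D + 5 * (D * S) + 31) *
      stepCost 64 (2 * n + l + 3) ≤ (100 * (10 * (64 * 6) ^ 2)) * (2 ^ n + l) ^ 4 := by
  have hn : n < 2 ^ n := Nat.lt_two_pow_self
  have hD : D ≤ 2 ^ n := hDS ▸ Nat.le_mul_of_pos_right D hS
  rw [hDS]
  generalize hX : 2 ^ n + l = X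
  have hX1 : 1 ≤ X := by omega
  have h1 : 7 * n + 7 * (2 * n + l + 3) + 11 * (D * D) + D + 5 * 2 ^ n + 31 ≤ 100 * X ^ 2 := by
    have hDX : D * D ≤ X * X := Nat.mul_le_mul (by omega) (by omega)
    have hXX : X ≤ X * X := Nat.le_mul_of_pos_left X hX1
    rw [pow_two]
    omega
  have h2 : stepCost 64 (2 * n + l + 3) ≤ 10 * (64 * 6) ^ 2 * X ^ 2 := by
    have : 64 * (2 * n + l + 3 + 1) ≤ 64 * 6 * X := by omega
    have := Nat.pow_le_pow_left this 2
    rw [mul_pow _ X] at this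
    unfold stepCost
    linarith
  calc _ ≤ (100 * X ^ 2) * (10 * (64 * 6) ^ 2 * X ^ 2) := Nat.mul_le_mul h1 h2
    _ = _ := by ring

theorem hasInput_inputMem {n p : ℕ} (F : ℤ[X]) {L : ℕ} (hp : 0 < p) (hL : n < L)
    (hpL : p < 2 ^ L) :
    HasInput n p (fun i => F.coeff i % (p : ℤ)) L (inputMem n p F) := by
  refine ⟨?_, rfl, rfl, fun _ => rfl⟩
  intro a i
  have h0 : bitLen 0 ≤ L := bitLen_le_iff.2 (by simp)
  match a, i with
  | 0, 0 => exact bitLen_natCast_le (hL.trans Nat.lt_two_pow_self)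
  | 0, 1 => exact bitLen_natCast_le hpL
  | 1, i => exact bitLen_emod_le hp hpL
  | 0, _ + 2 => exact h0
  | _ + 2, _ => exact h0

theorem runs_svpReduction_inputMem {n p r v m q d : ℕ} (hp : p.Prime) {F : ℤ[X]}
    {g : (ZMod p)[X]} (hr : r = min v n)
    (hq4 : p % 4 = 1 ∧ p = 2 * q + 1 ∨ p % 4 = 3 ∧ q = p + 1) (hm : Odd m) (hq : q = 2 ^ v * m)
    (hg : g ∣ X ^ 2 ^ r + 1) (hg0 : g ≠ 0) (hgd : g.natDegree = d) (hd : d = 1 ∨ d = 2)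
    (hFg : F.map (Int.castRingHom (ZMod p)) = expand (ZMod p) (2 ^ (n - r)) g)
    {O : Matrix (Fin (2 ^ r)) (Fin (2 ^ r)) ℤ → Fin (2 ^ r) → ℤ} (hO : SolvesSVP O) :
    ∃ (s : Mem) (t : ℕ), Exec O Prog.svpReduction (inputMem n p F) s t ∧
      t ≤ (100 * (10 * (64 * 6) ^ 2)) * (2 ^ n + Nat.log 2 p) ^ 4 ∧
      IsShortestVector ((polyLattice p (2 ^ n) (F.map (Int.castRingHom (ZMod p)))).map
        (coefVec (2 ^ n))) (intVec (outputVec s (2 ^ n))) := by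
  have := Fact.mk hp
  have hrn : r ≤ n := by omega
  have hS : 0 < 2 ^ (n - r) := by positivity
  have hp2 := hp.two_le
  have hDS := two_pow_mul_two_pow_sub hrn
  -- `2 * n` leaves room for the matrix index up to `D * D ≤ 2 ^ (2 * n)`, and the rest for `p` and
  -- `p + 1`.
  obtain ⟨L, hLdef⟩ : ∃ L, L = 2 * n + Nat.log 2 p + 3 := ⟨_, rfl⟩
  set φ : ℕ → ℤ := fun i => F.coeff i % (p : ℤ) with hφdef
  have hφ (k : ℕ) : (φ (k * 2 ^ (n - r)) : ZMod p) = g.coeff k := by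
    simp only [hφdef, ZMod.intCast_mod]
    have := congrArg (fun f => f.coeff (k * 2 ^ (n - r))) hFg
    simpa [coeff_expand_mul hS] using this
  have hφ0 (i : ℕ) : 0 ≤ φ i := Int.emod_nonneg _ (by omega)
  have hφp (i : ℕ) : φ i < p := Int.emod_lt_of_pos _ (by omega)
  have hdD : d ≤ 2 ^ r := by
    have := natDegree_le_of_dvd hg (monic_X_pow_two_pow_add_one (ZMod p) r).ne_zero
    rwa [hgd, natDegree_eq_of_degree_eq_some (degree_X_pow_two_pow_add_one (ZMod p) r)] at this
  obtain ⟨b, hb⟩ : ∃ b : ℕ, φ (d * 2 ^ (n - r)) = b := ⟨_, (Int.toNat_of_nonneg (hφ0 _)).symm⟩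
  have hbg : (b : ZMod p) = g.leadingCoeff := by
    rw [← Int.cast_natCast, ← hb, hφ, ← hgd, coeff_natDegree]
  have hd' : 0 < φ (2 * 2 ^ (n - r)) ∧ d = 2 ∨ ¬ 0 < φ (2 * 2 ^ (n - r)) ∧ d = 1 := by
    have h2 := hφ 2
    rcases hd with rfl | rfl
    · refine Or.inr ⟨?_, rfl⟩
      rw [coeff_eq_zero_of_natDegree_lt (by omega), ZMod.intCast_zmod_eq_zero_iff_dvd] at h2
      rw [Int.eq_zero_of_dvd_of_nonneg_of_lt (hφ0 _) (hφp _) h2]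
      exact lt_irrefl _
    · refine Or.inl ⟨lt_of_le_of_ne (hφ0 _) fun e => ?_, rfl⟩
      rw [← e, ← hgd, coeff_natDegree, Int.cast_zero] at h2
      exact hg0 (leadingCoeff_eq_zero.1 h2.symm)
  have hlog : p < 2 ^ (Nat.log 2 p + 1) := Nat.lt_pow_succ_log_self (by norm_num) p
  have hpow {i : ℕ} (h : i < L) : 2 ^ i < 2 ^ L := Nat.pow_lt_pow_right (by norm_num) h
  have hlogL : 2 ^ (Nat.log 2 p + 1) < 2 ^ L := hpow (by omega)
  have hpL : p < 2 ^ L := by omega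
  -- Whichever inverse the program finds, scaling `g` by a unit does not change the lattice, so the
  -- query is a basis of it.
  have hcG {c : ℕ} (hc : (c : ZMod p) * b = 1) :
      Matrix.det (fun i j : Fin (2 ^ r) => matrixEntry p φ (2 ^ (n - r)) d c i j) ≠ 0 ∧
      (polyLattice p (2 ^ r) g).map (coefVec (2 ^ r)) = Submodule.span ℤ
        (Set.range fun i : Fin (2 ^ r) =>
          intVec fun j : Fin (2 ^ r) => matrixEntry p φ (2 ^ (n - r)) d c i j) := by
    obtain ⟨G, hGm, hGd, hGmap, hGc⟩ := exists_monic_lift hp.one_lt hgd hφ (hbg ▸ hc)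
    have hmat := latticeMatrix_eq_matrixEntry (d := d) (D := 2 ^ r) hGc
    refine ⟨hmat ▸ det_latticeMatrix_ne_zero hGm hGd hp.ne_zero, ?_⟩
    have := map_coefVec_polyLattice hGm hGd hdD hp.ne_one
    rw [hGmap, polyLattice_C_mul (IsUnit.of_mul_eq_one _ hc), hmat] at this
    exact this
  have hshort {c : ℕ} (hc : (c : ZMod p) * b = 1) :
      IsShortestVector ((polyLattice p (2 ^ r) g).map (coefVec (2 ^ r)))
        (intVec (O fun i j => matrixEntry p φ (2 ^ (n - r)) d c i j)) := by
    rw [(hcG hc).2]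
    exact hO _ (hcG hc).1
  have hDn : (2 : ℕ) ^ r ≤ 2 ^ n := Nat.pow_le_pow_right (by norm_num) hrn
  obtain ⟨s, t, he, ht, c, hc, hout⟩ := runs_svpReduction (v := v) (S := 2 ^ (n - r)) O
    (hasInput_inputMem F hp.pos (by omega : n < L) hpL) hp (by omega) hpL
    (by rw [← pow_add]; exact hpow (by omega)) (by rw [hDS]; exact hpow (by omega))
    (by omega) hq4 hm hq (by rw [hr]) (by congr 1; omega) (by omega) hd' hb
    (by have := hφp (d * 2 ^ (n - r)); omega)
    (by rw [hbg]; exact leadingCoeff_ne_zero.2 hg0)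
    (fun c hc j => bitLen_le_iff.2
      ((natAbs_le_of_isShortestVector hp.ne_zero (hshort hc) j).trans_lt hpL))
  refine ⟨s, t, he, ht.trans (hLdef ▸ cost_bound hDS hS), ?_⟩
  obtain ⟨h, ⟨hh, -⟩, hOh⟩ := (hshort hc).1
  have hsv := isShortestVector_expand hS
    (isCoprime_X_of_dvd_X_pow_add_one (by positivity) hg) hh (hOh ▸ hshort hc)
  have hvec : intVec (outputVec s (2 ^ n)) =
      coefVec (2 ^ n) (expand ℤ (2 ^ (n - r)) h) := by
    rw [coefVec_eq]
    congr 1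
    ext i
    have hi : (i : ℕ) < 2 ^ r * 2 ^ (n - r) := hDS.symm ▸ i.2
    have hi' : (i : ℕ) / 2 ^ (n - r) < 2 ^ r := Nat.div_lt_of_lt_mul (by rwa [mul_comm])
    rw [outputVec, hout i hi hi', coeff_expand hS]
    have := congrFun (intVec_injective _ hOh) ⟨i / 2 ^ (n - r), hi'⟩
    simp only at this
    rw [this]
  rw [hDS, ← hFg] at hsv
  rwa [hvec]

theorem finrank_polyLattice_of_ne_zero {p D : ℕ} (hp : p.Prime) {g : (ZMod p)[X]} (hg0 : g ≠ 0)
    (hgD : g.natDegree ≤ D) : Module.finrank ℤ (polyLattice p D g) = D := by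
  have := Fact.mk hp
  -- With spacing 1, `exists_monic_lift` provides a monic integral lift of `g` divided by its
  -- leading coefficient.
  obtain ⟨φ, hφ⟩ : ∃ φ : ℕ → ℤ, ∀ k, (φ (k * 1) : ZMod p) = g.coeff k := by
    refine ⟨fun k => (g.coeff k).val, fun k => ?_⟩
    simp
  have hlc : (((g.leadingCoeff⁻¹).val : ℕ) : ZMod p) * g.leadingCoeff = 1 := by
    rw [ZMod.natCast_zmod_val]
    exact inv_mul_cancel₀ (leadingCoeff_ne_zero.2 hg0)
  obtain ⟨G, hGm, hGd, hGmap, -⟩ := exists_monic_lift hp.one_lt rfl hφ hlc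
  have := finrank_polyLattice (N := D) hGm hGd hgD hp.ne_one hp.ne_zero
  rwa [hGmap, polyLattice_C_mul (IsUnit.of_mul_eq_one _ hlc)] at this

theorem mainTheorem2 :
    ∃ (M : Prog) (C k : ℕ),
      ∀ (n : ℕ) (ζ : ℂ), IsPrimitiveRoot ζ (2 ^ (n + 1)) →
      ∀ p : ℕ, p.Prime → p ≠ 2 →
      ∀ F : ℤ[X], Irreducible (F.map (Int.castRingHom (ZMod p))) →
        F.map (Int.castRingHom (ZMod p)) ∣ X ^ (2 ^ n) + 1 →
      ∀ P : Ideal (Algebra.adjoin ℤ {ζ}),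
        P = Ideal.span {(p : Algebra.adjoin ℤ {ζ}), aeval (adjoinGen ζ) F} →
      ∀ A m r : ℕ, Odd m → 2 ≤ A →
        (p % 4 = 1 ∧ p = 2 ^ A * m + 1 ∧ r = min (A - 1) n ∨
          p % 4 = 3 ∧ p + 1 = 2 ^ A * m ∧ r = min A n) →
      ∀ (K : IntermediateField ℚ ℂ) (c : Submodule ℤ ℂ),
        K = IntermediateField.adjoin ℚ {ζ ^ 2 ^ (n - r)} →
        c = idealInC P ⊓ integersInC K →
      -- `P` is the direct sum of the `ζ ^ k • c`, `0 ≤ k < 2 ^ (n - r)`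
      (iSupIndep (fun j : Fin (2 ^ (n - r)) => c.map (LinearMap.mulLeft ℤ (ζ ^ (j : ℕ)))) ∧
        ⨆ j : Fin (2 ^ (n - r)), c.map (LinearMap.mulLeft ℤ (ζ ^ (j : ℕ))) = idealInC P) ∧
      -- `c` has rank `2 ^ r` and the same `λ₁` as `P`
      Module.finrank ℤ (coeffLattice ζ (2 ^ n) c) = 2 ^ r ∧
      lambda1 (coeffLattice ζ (2 ^ n) (idealInC P)) = lambda1 (coeffLattice ζ (2 ^ n) c) ∧
      -- `M` finds a shortest vector of `P` in polynomial time, given an SVP oracle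
      ∀ O : Matrix (Fin (2 ^ r)) (Fin (2 ^ r)) ℤ → Fin (2 ^ r) → ℤ, SolvesSVP O →
        ∃ (s : Mem) (t : ℕ), Exec O M (inputMem n p F) s t ∧
          t ≤ C * (2 ^ n + Nat.log 2 p) ^ k ∧
          IsShortestVector (coeffLattice ζ (2 ^ n) (idealInC P))
            (intVec (outputVec s (2 ^ n))) := by
  refine ⟨Prog.svpReduction, 100 * (10 * (64 * 6) ^ 2), 4, ?_⟩
  rintro n ζ hζ p hp hp2 F hFirr hF _ rfl A m r hm hA hcase _ _ rfl rfl
  have := Fact.mk hp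
  obtain ⟨g, hFg, hgirr, hg, hgd⟩ := exists_eq_expand hp2 hm hA hcase hFirr hF
  have hr : r ≤ n := by omega
  have hS : 0 < 2 ^ (n - r) := by positivity
  have hDS := two_pow_mul_two_pow_sub hr
  have hX : IsCoprime g X := isCoprime_X_of_dvd_X_pow_add_one (by positivity) hg
  have hgD : g.natDegree ≤ 2 ^ r := by
    have := natDegree_le_of_dvd hg (monic_X_pow_two_pow_add_one (ZMod p) r).ne_zero
    rwa [natDegree_eq_of_degree_eq_some (degree_X_pow_two_pow_add_one (ZMod p) r)] at this
  have hlatP : coeffLattice ζ (2 ^ n) (idealInC (Ideal.span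
      {(p : Algebra.adjoin ℤ {ζ}), aeval (adjoinGen ζ) F})) =
      (polyLattice p (2 ^ n) (F.map (Int.castRingHom (ZMod p)))).map (coefVec (2 ^ n)) := by
    rw [idealInC_eq_map hζ hF, coeffLattice_map hζ _ fun h hh => (mem_polyLattice.1 hh).1]
  rw [idealInC_inf_integersInC hζ hr hg hFg hF, hlatP, coeffLattice_map hζ]
  · refine ⟨⟨iSupIndep_map_mulLeft hζ hr _ fun h hh => (mem_polyLattice.1 hh).1,
      iSup_map_mulLeft hζ hr hg hFg hF⟩, ?_, ?_, ?_⟩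
    · have := finrank_map_expand_polyLattice (p := p) (D := 2 ^ r) (g := g) hS
      rw [hDS, finrank_polyLattice_of_ne_zero hp hgirr.ne_zero hgD] at this
      exact this
    · have := lambda1_map_polyLattice_expand (p := p) (D := 2 ^ r) hS hX
        (Submodule.ne_bot_iff _ |>.2 ⟨_, C_mem_polyLattice g (by positivity), by
          rw [Ne, C_eq_zero]; exact_mod_cast hp.ne_zero⟩)
      rw [hDS, ← hFg] at this
      exact this
    · intro O hO
      -- `q` is the number from which the program extracts powers of 2, and `v` is its 2-adic
      -- valuation; this unifies the two residue classes of `p`.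
      obtain ⟨v, q, hrv, hq4, hq⟩ : ∃ v q, r = min v n ∧
          (p % 4 = 1 ∧ p = 2 * q + 1 ∨ p % 4 = 3 ∧ q = p + 1) ∧ q = 2 ^ v * m := by
        rcases hcase with ⟨h4, hpA, hrA⟩ | ⟨h4, hpA, hrA⟩
        · refine ⟨A - 1, 2 ^ (A - 1) * m, hrA, Or.inl ⟨h4, ?_⟩, rfl⟩
          rw [← mul_assoc, ← pow_succ', show A - 1 + 1 = A by omega]
          exact hpA
        · exact ⟨A, 2 ^ A * m, hrA, Or.inr ⟨h4, hpA.symm⟩, rfl⟩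
      exact runs_svpReduction_inputMem hp hrv hq4 hm hq hg hgirr.ne_zero rfl hgd hFg hO
  · rintro _ ⟨h, hh, rfl⟩
    rw [← hDS]
    exact degree_expand_lt hS hh.1
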